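/- **Setting.** All Hilbert spaces are finite-dimensional and nonzero, with fixed standard bases; $\log=\log_2$; $T_X$ is the (partial) transpose on $X$ in the standard basis. A quantum broadcast channel $\mathcal N^{A'\to BC}$ is a completely positive trace-preserving linear map from operators on $A'$ to operators on $B\otimes C$; its Choi matrix is $N^{A'BC}=\sum_{i,j}|i\rangle\langle j|^{A'}\otimes\mathcal N(|i\rangle\langle j|)$. A code of size $(r_1,r_2)$, with integers $r_1,r_2\ge 1$, is a quantum channel $\mathcal Z^{ABC\to A'B'C'}$ with $A=A_1\otimes A_2$, $|A_1|=|B'|=r_1$, $|A_2|=|C'|=r_2$, that is no-signalling from $BC$ to $A$, i.e. $\operatorname{Tr}_{B'C'}\circ\mathcal Z=\mathcal Z_a\circ\operatorname{Tr}_{BC}$ for some channel $\mathcal Z_a^{A\to A'}$. It is *no-signalling* (NS) if in addition, in the same sense, $A\not\to BC$, $B\not\to AC$ and $C\not\to AB$. It is *PPT-preserving* if its Choi matrix $Z$ satisfies $Z^{T_{AA'}}\ge0$, $Z^{T_{BB'}}\ge0$ and $Z^{T_{CC'}}\ge 0$. Connecting the output $A'$ of $\mathcal Z$ through $\mathcal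 N$ to the inputs $B,C$ of $\mathcal Z$ gives the induced map $\mathcal M^{A_1A_2\to B'C'}(X)=\sum_{i,j}\langle i|^{A'}\,\mathcal Z\big(X\otimes\mathcal N(|i\rangle\langle j|)\big)\,|j\rangle^{A'}$. With $\phi$ the (normalized) maximally entangled state, the channel fidelity of the code is $\operatorname{Tr}\,\phi^{\widetilde A_1B'}\phi^{\widetilde A_2C'}\,\mathcal M(\phi^{\widetilde A_1A_1}\phi^{\widetilde A_2A_2})$, and $F^{PPT\cap NS}(\mathcal N,r_1,r_2)$ is its supremum over all codes of size $(r_1,r_2)$ that are NS and PPT-preserving. The $\varepsilon$-one-shot sum-capacity is $$Q_1^{PPT\cap NS}(\mathcal N,\varepsilon)=\max\{\log r_1+\log r_2:\ r_1,r_2\in\mathbb N_{\ge1},\ F^{PPT\cap NS}(\mathcal N,r_1,r_2)\ge 1-\varepsilon\}.$$ **Proposition.** For every quantum broadcast channel $\mathcal N^{A'\to BC}$ and every $0\le\varepsilon<1$, the above maximum is attained and $$Q_1^{PPT\cap NS}(\mathcal N,\varepsilon)\le\log\Gamma(\mathcal N)-\log(1-\varepsilon),$$ where $\Gamma(\mathcal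 N)>0$ is the optimal value of the semidefinite program $$\Gamma(\mathcal N)=\max\ \operatorname{Tr}R^{A'BC}(N^{A'BC})^T$$ over operators $R^{A'BC},\rho^{A'}\ge0$ and $m\in\mathbb R$ subject to $\operatorname{Tr}\rho^{A'}=1$, $\operatorname{Tr}_{A'}R^{A'BC}=m\,\mathbb 1^{BC}$ and $-\rho^{A'}\otimes\mathbb 1^{BC}\le(R^{A'BC})^{T_{BC}}\le\rho^{A'}\otimes\mathbb 1^{BC}$. Moreover strong duality holds: $\Gamma(\mathcal N)$ is also the optimal value of the dual program $$\Gamma(\mathcal N)=\min\ \mu$$ over $\mu\in\mathbb R$, operators $V^{A'BC},Y^{A'BC}\ge0$ and Hermitian $W^{BC}$ subject to $(N^{A'BC})^T\le(V^{A'BC}-Y^{A'BC})^{T_{BC}}+\mathbb 1^{A'}\otimes W^{BC}$, $\operatorname{Tr}_{BC}(V^{A'BC}+Y^{A'BC})\le\mu\,\mathbb 1^{A'}$ and $\operatorname{Tr}W^{BC}\le0$. The primal maximum and the dual minimum are both attained. -/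

import Mathlib

open scoped Kronecker ComplexOrder

namespace BroadcastCode

/-- Operators on the finite-dimensional Hilbert space with standard orthonormal basis `ι`. -/
abbrev Op (ι : Type*) : Type _ := Matrix ι ι ℂ

section Basic

variable {ι κ o : Type*}

/-- The partial trace over the first tensor factor. -/
def traceFst [Fintype ι] (X : Op (ι × κ)) : Op κ :=
  Matrix.of fun k l => ∑ i, X (i, k) (i, l)

/-- The partial trace over the second tensor factor. -/
def traceSnd [Fintype κ] (X : Op (ι × κ)) : Op ι :=
  Matrix.of fun i j => ∑ k, X (i, k) (j, k)

/-- The partial trace over the middle one of three tensor factors. -/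
def traceMid [Fintype κ] (X : Op (ι × κ × o)) : Op (ι × o) :=
  Matrix.of fun p q => ∑ k, X (p.1, k, p.2) (q.1, k, q.2)

/-- The partial trace over the last one of three tensor factors. -/
def traceLast [Fintype o] (X : Op (ι × κ × o)) : Op (ι × κ) :=
  Matrix.of fun p q => ∑ k, X (p.1, p.2, k) (q.1, q.2, k)

/-- The partial transpose on the second tensor factor, in the standard basis. -/
def transposeSnd (X : Op (ι × κ)) : Op (ι × κ) :=
  Matrix.of fun p q => X (p.1, q.2) (q.1, p.2)

/-- The map `id ⊗ Φ`, where the identity acts on a reference system with basis `κ`. -/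
def idTensor (Φ : Op ι →ₗ[ℂ] Op o) (X : Op (κ × ι)) : Op (κ × o) :=
  Matrix.of fun p q => Φ (Matrix.of fun i j => X (p.1, i) (q.1, j)) p.2 q.2

/-- A quantum channel: a completely positive and trace-preserving linear map. -/
structure IsChannel [Fintype ι] [Fintype o] (Φ : Op ι →ₗ[ℂ] Op o) : Prop where
  completelyPositive : ∀ (k : ℕ) (X : Op (Fin k × ι)), X.PosSemidef → (idTensor Φ X).PosSemidef
  tracePreserving : ∀ X : Op ι, (Φ X).trace = X.trace

/-- The unnormalized maximally entangled operator `∑ i j, |i i⟩⟨j j|`. -/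
def maxEnt (ι : Type*) [DecidableEq ι] : Op (ι × ι) :=
  Matrix.of fun p q => if p.1 = p.2 ∧ q.1 = q.2 then 1 else 0

/-- The EPR pair (maximally entangled state) on two copies of the space with basis `ι`.
For `ι = ι₁ × ι₂` this is the product of the EPR pairs on two copies of `ι₁` and on two copies
of `ι₂`. -/
noncomputable def epr (ι : Type*) [Fintype ι] [DecidableEq ι] : Op (ι × ι) :=
  ((Fintype.card ι : ℂ)⁻¹) • maxEnt ι

/-- The Choi matrix of a channel, with respect to the unnormalized maximally entangled operator;
the reference copy of the input is the first tensor factor. -/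
def choi [DecidableEq ι] (Φ : Op ι →ₗ[ℂ] Op o) : Op (ι × o) :=
  idTensor Φ (maxEnt ι)

end Basic

section Tripartite

/-! Tripartite maps with inputs `A`, `B`, `C` and outputs `A'`, `B'`, `C'`: Alice holds `A`, `A'`,
Bob holds `B`, `B'` and Charlie holds `C`, `C'`. -/

variable {A B C A' B' C' : Type*}

/-- `A ↛ BC`: the output of Bob and Charlie arises from their input by a channel of their own. -/
def NoSignalAtoBC [Fintype A] [Fintype B] [Fintype C] [Fintype A'] [Fintype B'] [Fintype C']
    (Z : Op (A × B × C) →ₗ[ℂ] Op (A' × B' × C')) : Prop :=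
  ∃ Φ : Op (B × C) →ₗ[ℂ] Op (B' × C'), IsChannel Φ ∧ ∀ X, traceFst (Z X) = Φ (traceFst X)

/-- `B ↛ AC`. -/
def NoSignalBtoAC [Fintype A] [Fintype B] [Fintype C] [Fintype A'] [Fintype B'] [Fintype C']
    (Z : Op (A × B × C) →ₗ[ℂ] Op (A' × B' × C')) : Prop :=
  ∃ Φ : Op (A × C) →ₗ[ℂ] Op (A' × C'), IsChannel Φ ∧ ∀ X, traceMid (Z X) = Φ (traceMid X)

/-- `C ↛ AB`. -/
def NoSignalCtoAB [Fintype A] [Fintype B] [Fintype C] [Fintype A'] [Fintype B'] [Fintype C']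
    (Z : Op (A × B × C) →ₗ[ℂ] Op (A' × B' × C')) : Prop :=
  ∃ Φ : Op (A × B) →ₗ[ℂ] Op (A' × B'), IsChannel Φ ∧ ∀ X, traceLast (Z X) = Φ (traceLast X)

/-- `BC ↛ A`: Alice's output arises from her input by a channel of her own. -/
def NoSignalBCtoA [Fintype A] [Fintype B] [Fintype C] [Fintype A'] [Fintype B'] [Fintype C']
    (Z : Op (A × B × C) →ₗ[ℂ] Op (A' × B' × C')) : Prop :=
  ∃ Φ : Op A →ₗ[ℂ] Op A', IsChannel Φ ∧ ∀ X, traceSnd (Z X) = Φ (traceSnd X)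

/-- A forward-assisted code: a tripartite channel in which the receivers cannot signal to the
sender. -/
structure IsForwardAssisted [Fintype A] [Fintype B] [Fintype C]
    [Fintype A'] [Fintype B'] [Fintype C']
    (Z : Op (A × B × C) →ₗ[ℂ] Op (A' × B' × C')) : Prop where
  channel : IsChannel Z
  causal : NoSignalBCtoA Z

/-- The no-signalling conditions. -/
structure IsNoSignalling [Fintype A] [Fintype B] [Fintype C]
    [Fintype A'] [Fintype B'] [Fintype C']
    (Z : Op (A × B × C) →ₗ[ℂ] Op (A' × B' × C')) : Prop where
  a_to_bc : NoSignalAtoBC Z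
  b_to_ac : NoSignalBtoAC Z
  c_to_ab : NoSignalCtoAB Z

/-- The partial transpose on Alice's systems `A A'`. -/
def transposeA (X : Op ((A × B × C) × (A' × B' × C'))) : Op ((A × B × C) × (A' × B' × C')) :=
  Matrix.of fun p q =>
    X ((q.1.1, p.1.2.1, p.1.2.2), (q.2.1, p.2.2.1, p.2.2.2))
      ((p.1.1, q.1.2.1, q.1.2.2), (p.2.1, q.2.2.1, q.2.2.2))

/-- The partial transpose on Bob's systems `B B'`. -/
def transposeB (X : Op ((A × B × C) × (A' × B' × C'))) : Op ((A × B × C) × (A' × B' × C')) :=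
  Matrix.of fun p q =>
    X ((p.1.1, q.1.2.1, p.1.2.2), (p.2.1, q.2.2.1, p.2.2.2))
      ((q.1.1, p.1.2.1, q.1.2.2), (q.2.1, p.2.2.1, q.2.2.2))

/-- The partial transpose on Charlie's systems `C C'`. -/
def transposeC (X : Op ((A × B × C) × (A' × B' × C'))) : Op ((A × B × C) × (A' × B' × C')) :=
  Matrix.of fun p q =>
    X ((p.1.1, p.1.2.1, q.1.2.2), (p.2.1, p.2.2.1, q.2.2.2))
      ((q.1.1, q.1.2.1, p.1.2.2), (q.2.1, q.2.2.1, p.2.2.2))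

/-- A (completely) PPT-preserving tripartite map: its Choi matrix has a positive semidefinite
partial transpose across each of the three cuts. -/
structure IsPPTPreserving [DecidableEq A] [DecidableEq B] [DecidableEq C]
    [Fintype A] [Fintype B] [Fintype C] [Fintype A'] [Fintype B'] [Fintype C']
    (Z : Op (A × B × C) →ₗ[ℂ] Op (A' × B' × C')) : Prop where
  ppt_a : (transposeA (choi Z)).PosSemidef
  ppt_b : (transposeB (choi Z)).PosSemidef
  ppt_c : (transposeC (choi Z)).PosSemidef

/-- The map from `A` to `B' C'` obtained by connecting Alice's output `A'` of `Z` through the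
broadcast channel `N` to the inputs `B`, `C` of `Z`. If `Z = D ∘ E` with `E` from `A` to `A' R`
and `D` from `R B C` to `B' C'`, it is `D ∘ N ∘ E`. -/
def induced [Fintype A'] [DecidableEq A'] (Z : Op (A × B × C) →ₗ[ℂ] Op (A' × B' × C'))
    (N : Op A' →ₗ[ℂ] Op (B × C)) : Op A →ₗ[ℂ] Op (B' × C') where
  toFun X := Matrix.of fun p q =>
    ∑ i, ∑ j, Z (X ⊗ₖ N (Matrix.single i j 1)) (i, p) (j, q)
  map_add' X Y := by
    ext p q
    simp [Matrix.add_kronecker, Finset.sum_add_distrib]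
  map_smul' c X := by
    ext p q
    simp [Matrix.smul_kronecker, Finset.mul_sum]

end Tripartite

section Capacity

variable {A' B C : Type*} [Fintype A'] [Fintype B] [Fintype C]
  [DecidableEq A'] [DecidableEq B] [DecidableEq C]

/-- The candidates for a code of size `(r₁, r₂)` for a broadcast channel from `A'` to `B C`. Alice's
input is `A₁ A₂` with `|A₁| = r₁` and `|A₂| = r₂`, and `|B'| = r₁`, `|C'| = r₂`. -/
abbrev CodeMap (A' B C : Type*) (r₁ r₂ : ℕ) : Type _ :=
  Op ((Fin r₁ × Fin r₂) × B × C) →ₗ[ℂ] Op (A' × Fin r₁ × Fin r₂)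

/-- The codes in the class `PPT ∩ NS`. -/
structure IsPPTNSCode {r₁ r₂ : ℕ} (Z : CodeMap A' B C r₁ r₂) : Prop where
  forwardAssisted : IsForwardAssisted Z
  noSignalling : IsNoSignalling Z
  pptPreserving : IsPPTPreserving Z

/-- The channel fidelity of a code for `N`: the overlap of the two EPR pairs with the state
obtained by sending one half of each of them through the induced channel. -/
noncomputable def channelFidelity (N : Op A' →ₗ[ℂ] Op (B × C)) {r₁ r₂ : ℕ}
    (Z : CodeMap A' B C r₁ r₂) : ℝ :=
  (epr (Fin r₁ × Fin r₂) * idTensor (induced Z N) (epr (Fin r₁ × Fin r₂))).trace.re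

/-- The maximal channel fidelity of `N` over the codes in `PPT ∩ NS` of size `(r₁, r₂)`. -/
noncomputable def maxFidelity (N : Op A' →ₗ[ℂ] Op (B × C)) (r₁ r₂ : ℕ) : ℝ :=
  sSup {f | ∃ Z : CodeMap A' B C r₁ r₂, IsPPTNSCode Z ∧ channelFidelity N Z = f}

/-- The values `R₁ + R₂` over all `ε`-one-shot achievable rate pairs
`(R₁, R₂) = (log r₁, log r₂)`. -/
def achievableSumRates (N : Op A' →ₗ[ℂ] Op (B × C)) (ε : ℝ) : Set ℝ :=
  {R | ∃ r₁ r₂ : ℕ, 1 ≤ r₁ ∧ 1 ≤ r₂ ∧ 1 - ε ≤ maxFidelity N r₁ r₂ ∧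
    R = Real.logb 2 r₁ + Real.logb 2 r₂}

/-- The `ε`-one-shot sum-capacity assisted by PPT-preserving and no-signalling codes. -/
noncomputable def oneShotSumCapacity (N : Op A' →ₗ[ℂ] Op (B × C)) (ε : ℝ) : ℝ :=
  sSup (achievableSumRates N ε)

/-- The feasible points `(R, ρ, m)` of the primal program. -/
structure PrimalFeasible (R : Op (A' × B × C)) (ρ : Op A') (m : ℝ) : Prop where
  R_nonneg : R.PosSemidef
  rho_nonneg : ρ.PosSemidef
  rho_trace : ρ.trace = 1
  marginal : traceFst R = (m : ℂ) • (1 : Op (B × C))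
  lower : (transposeSnd R - -(ρ ⊗ₖ (1 : Op (B × C)))).PosSemidef
  upper : (ρ ⊗ₖ (1 : Op (B × C)) - transposeSnd R).PosSemidef

/-- The values `Tr R Nᵀ` of the primal program. -/
def primalValues (N : Op A' →ₗ[ℂ] Op (B × C)) : Set ℝ :=
  {x | ∃ R ρ m, PrimalFeasible R ρ m ∧ (R * (choi N).transpose).trace.re = x}

/-- The feasible points `(V, Y, W, μ)` of the dual program. -/
structure DualFeasible (N : Op A' →ₗ[ℂ] Op (B × C))
    (V Y : Op (A' × B × C)) (W : Op (B × C)) (μ : ℝ) : Prop where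
  V_nonneg : V.PosSemidef
  Y_nonneg : Y.PosSemidef
  W_hermitian : W.IsHermitian
  W_trace : W.trace.re ≤ 0
  dominates : (transposeSnd (V - Y) + (1 : Op A') ⊗ₖ W - (choi N).transpose).PosSemidef
  bound : ((μ : ℂ) • (1 : Op A') - traceSnd (V + Y)).PosSemidef

/-- The values `μ` of the dual program. -/
def dualValues (N : Op A' →ₗ[ℂ] Op (B × C)) : Set ℝ :=
  {μ | ∃ V Y W, DualFeasible N V Y W μ}

/-- The quantity `Γ(N)`, the optimal value of the primal program. -/
noncomputable def gammaValue (N : Op A' →ₗ[ℂ] Op (B × C)) : ℝ :=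
  sSup (primalValues N)

end Capacity

end BroadcastCode

/-! ### Positive semidefinite matrices and the real functionals nonnegative on them. -/

namespace Matrix

variable {n : Type*} [Fintype n]

/-! Capacity bound. Contracting the Choi matrix `Z` of a code with the maximally entangled vector
between Alice's input and the outputs B'C', scaled by 1/(r₁r₂), gives an operator R
(`codeOperator`), and the channel fidelity equals Tr(R Nᵀ)/(r₁r₂)
(`channelFidelity_eq_trace_codeOperator`). This R is primal feasible. Positivity comes from `Z`
being a channel. No signalling from A to BC makes its marginal 1/(r₁r₂) times the identity. For the
two-sided bound, the partial transpose turns the entangled projector into the swap S, and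
contracting the PPT matrix of `Z` with 1 ± S ≥ 0 gives ρ⊗1 ± R^{T_BC} ≥ 0, where no signalling from
BC to A identifies ρ as Alice's output on the maximally mixed input
(`posSemidef_kronecker_add_transposeSnd_codeOperator`). Hence the fidelity is at most Γ/(r₁r₂), so
r₁r₂(1-ε) ≤ Γ for achievable sizes. Only finitely many sizes remain, and the completely depolarizing
code of size (1,1) has fidelity 1, so the maximum is attained.

Duality. The primal feasible set is compact, which gives the primal maximum, and weak duality pairs
the constraints. For the dual minimum, the functional Γ·Tr ρ - Tr(R Nᵀ) is nonnegative where the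
linear subspace of tuples (R, ρ, ρ⊗1+R^{T_BC}, ρ⊗1-R^{T_BC}) meets the positive cone. That subspace
contains an interior point of the cone, so the M. Riesz theorem extends the functional to one
nonnegative on the whole cone. Its four components are positive semidefinite matrices: two are the
dual variables Y and V, the other two are the slacks of the dual constraints
(`exists_nonneg_functional`, `exists_dualFeasible_gammaValue`). -/

theorem PosSemidef.exists_eq_conjTranspose_mul_self {P : Matrix n n ℂ} (hP : P.PosSemidef) :
    ∃ B : Matrix n n ℂ, P = Bᴴ * B := by
  classical
  open scoped MatrixOrder in
  exact CStarAlgebra.nonneg_iff_eq_star_mul_self.mp hP.nonneg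

theorem PosSemidef.trace_mul_nonneg {P Q : Matrix n n ℂ} (hP : P.PosSemidef)
    (hQ : Q.PosSemidef) : 0 ≤ (P * Q).trace := by
  obtain ⟨B, rfl⟩ := hP.exists_eq_conjTranspose_mul_self
  rw [Matrix.mul_assoc, trace_mul_comm]
  exact (hQ.mul_mul_conjTranspose_same B).trace_nonneg

theorem PosSemidef.re_trace_mul_nonneg {P Q : Matrix n n ℂ} (hP : P.PosSemidef)
    (hQ : Q.PosSemidef) : 0 ≤ (P * Q).trace.re :=
  (Complex.nonneg_iff.mp (hP.trace_mul_nonneg hQ)).1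

theorem PosSemidef.diag_re_le_trace {P : Matrix n n ℂ} (hP : P.PosSemidef) (i : n) :
    (P i i).re ≤ P.trace.re := by
  rw [trace, Complex.re_sum]
  exact Finset.single_le_sum (f := fun i => (P i i).re)
    (fun j _ => (Complex.nonneg_iff.mp hP.diag_nonneg).1) (Finset.mem_univ i)

/-- Writing P = BᴴB, the inequality 2xy ≤ x²+y² bounds an entry by the mean of two diagonal entries.
This supplies the boundedness of the primal feasible set. -/
theorem PosSemidef.norm_apply_le_trace {P : Matrix n n ℂ} (hP : P.PosSemidef) (i j : n) :
    ‖P i j‖ ≤ P.trace.re := by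
  have hi := hP.diag_re_le_trace i
  have hj := hP.diag_re_le_trace j
  obtain ⟨B, hB⟩ := hP.exists_eq_conjTranspose_mul_self
  have hd : ∀ i, (P i i).re = ∑ k, ‖B k i‖ ^ 2 := by
    intro i
    simp only [hB, mul_apply, conjTranspose_apply, Complex.re_sum]
    refine Finset.sum_congr rfl fun k _ => ?_
    rw [RCLike.star_def, Complex.conj_mul', ← Complex.ofReal_pow, Complex.ofReal_re]
  have : ‖P i j‖ ≤ ∑ k, (‖B k i‖ ^ 2 + ‖B k j‖ ^ 2) / 2 := by
    rw [hB, mul_apply]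
    refine (norm_sum_le _ _).trans (Finset.sum_le_sum fun k _ => ?_)
    rw [conjTranspose_apply, norm_mul, norm_star]
    nlinarith [sq_nonneg (‖B k i‖ - ‖B k j‖)]
  rw [← Finset.sum_div, Finset.sum_add_distrib, ← hd, ← hd] at this
  linarith

theorem isClosed_setOf_posSemidef : IsClosed {X : Matrix n n ℂ | X.PosSemidef} := by
  simp only [posSemidef_iff_dotProduct_mulVec, Set.ofPred_and, Set.ofPred_forall]
  refine IsClosed.inter (isClosed_eq (by fun_prop) continuous_id) (isClosed_iInter fun x => ?_)
  exact isClosed_le continuous_const (by fun_prop)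

theorem IsHermitian.exists_posSemidef_smul_one_add [DecidableEq n] {H : Matrix n n ℂ}
    (hH : H.IsHermitian) : ∃ t₀ : ℝ, ∀ t : ℝ, t₀ ≤ t → ((t : ℂ) • (1 : Matrix n n ℂ)
      + H).PosSemidef := by
  open scoped Matrix.Norms.L2Operator MatrixOrder in
  refine ⟨‖H‖, fun t ht => ?_⟩
  have h1 : (H - -algebraMap ℝ (Matrix n n ℂ) ‖H‖).PosSemidef :=
    le_iff.mp (IsSelfAdjoint.neg_algebraMap_norm_le_self (a := H) hH)
  have h2 : (((t - ‖H‖ : ℝ) : ℂ) • (1 : Matrix n n ℂ)).PosSemidef :=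
    PosSemidef.one.smul (by exact_mod_cast sub_nonneg.mpr ht)
  convert h1.add h2 using 1
  rw [Algebra.algebraMap_eq_smul_one, ← Complex.coe_smul, sub_neg_eq_add, add_assoc, ← add_smul,
    add_comm]
  congr 2
  push_cast
  ring

/-- The matrices with positive semidefinite Hermitian part. -/
def accretiveCone (n : Type*) : PointedCone ℝ (Matrix n n ℂ) where
  carrier := {X | (X + Xᴴ).PosSemidef}
  add_mem' {X Y} hX hY := by
    have := hX.add hY
    rw [Set.mem_ofPred_eq, conjTranspose_add]
    convert this using 1
    abel
  zero_mem' := by simp [PosSemidef.zero]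
  smul_mem' c X hX := by
    have := hX.smul c.2
    change ((c : ℝ) • X + ((c : ℝ) • X)ᴴ).PosSemidef
    rwa [conjTranspose_smul, star_trivial, ← smul_add]

omit [Fintype n] in
theorem mem_accretiveCone {X : Matrix n n ℂ} : X ∈ accretiveCone n ↔ (X + Xᴴ).PosSemidef :=
  Iff.rfl

omit [Fintype n] in
theorem PosSemidef.mem_accretiveCone {X : Matrix n n ℂ} (hX : X.PosSemidef) :
    X ∈ accretiveCone n :=
  hX.add hX.conjTranspose

/-- The identity is an order unit of the cone. The cone lives in the space of all matrices, so no
restriction to Hermitian ones is needed in the extension argument. -/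
theorem exists_smul_one_add_mem_accretiveCone [DecidableEq n] (X : Matrix n n ℂ) :
    ∃ t₀ : ℝ, ∀ t : ℝ, t₀ ≤ t → (t : ℂ) • (1 : Matrix n n ℂ) + X ∈ accretiveCone n := by
  obtain ⟨t₀, h⟩ := (isHermitian_add_transpose_self X).exists_posSemidef_smul_one_add
  refine ⟨t₀ / 2, fun t ht => ?_⟩
  rw [mem_accretiveCone]
  convert h (2 * t) (by linarith) using 1
  ext i j
  by_cases hij : i = j
  · subst hij; simp; ring
  · simp [hij]

theorem exists_re_trace_mul_eq [DecidableEq n] (g : Matrix n n ℂ →ₗ[ℝ] ℝ) :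
    ∃ G : Matrix n n ℂ, ∀ X, g X = (G * X).trace.re := by
  -- Chosen because Re((a - ib)(x + iy)) = ax + by.
  refine ⟨of fun j i => (g (single i j 1) : ℂ) - Complex.I * g (single i j Complex.I), fun X => ?_⟩
  have hX : X = ∑ i, ∑ j, ((X i j).re • single i j (1 : ℂ) + (X i j).im • single i j Complex.I)
    := by
    conv_lhs => rw [matrix_eq_sum_single X]
    refine Finset.sum_congr rfl fun i _ => Finset.sum_congr rfl fun j _ => ?_
    rw [smul_single, smul_single, ← single_add]
    congr 1
    apply Complex.ext <;> simp
  conv_lhs => rw [hX]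
  simp only [map_sum, map_add, map_smul, trace, diag_apply, mul_apply, of_apply, Complex.re_sum]
  rw [Finset.sum_comm]
  refine Finset.sum_congr rfl fun j _ => Finset.sum_congr rfl fun i _ => ?_
  simp
  ring

theorem trace_mul_vecMulVec (G : Matrix n n ℂ) (v : n → ℂ) :
    (G * vecMulVec v (star v)).trace = star v ⬝ᵥ (G *ᵥ v) := by
  rw [mul_vecMulVec, trace_vecMulVec, dotProduct_comm]

theorem posSemidef_of_dotProduct_mulVec_nonneg {G : Matrix n n ℂ}
    (h : ∀ v : n → ℂ, 0 ≤ star v ⬝ᵥ (G *ᵥ v)) : G.PosSemidef := by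
  classical
  rw [← isPositive_toEuclideanLin_iff, LinearMap.isPositive_iff_complex]
  intro x
  have hx : inner ℂ (G.toEuclideanLin x) x = star (star x.ofLp ⬝ᵥ (G *ᵥ x.ofLp)) := by
    rw [← star_dotProduct_star, star_star, EuclideanSpace.inner_eq_star_dotProduct,
      dotProduct_comm]
    rfl
  have h0 := Complex.nonneg_iff.mp (h x.ofLp)
  rw [hx]
  refine ⟨Complex.ext (by simp) ?_, ?_⟩
  · simp [← h0.2]
  · simpa using h0.1

/-- A real functional that is nonnegative on the accretive matrices is given by a positive
semidefinite matrix. -/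
theorem exists_posSemidef_of_nonneg [DecidableEq n] (g : Matrix n n ℂ →ₗ[ℝ] ℝ)
    (hg : ∀ X ∈ accretiveCone n, 0 ≤ g X) :
    ∃ G : Matrix n n ℂ, G.PosSemidef ∧ ∀ X, g X = (G * X).trace.re := by
  obtain ⟨G, hG⟩ := exists_re_trace_mul_eq g
  refine ⟨G, posSemidef_of_dotProduct_mulVec_nonneg fun v => ?_, hG⟩
  have h0 : 0 ≤ g (vecMulVec v (star v)) :=
    hg _ (posSemidef_vecMulVec_self_star v).mem_accretiveCone
  -- Skew-Hermitian matrices lie in the cone with both signs, which forces the quadratic form of G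
  -- to be real.
  have hmem : ∀ c : ℝ, (c * Complex.I : ℂ) • vecMulVec v (star v) ∈ accretiveCone n := by
    intro c
    rw [mem_accretiveCone, conjTranspose_smul, (posSemidef_vecMulVec_self_star v).1.eq]
    simp [PosSemidef.zero]
  have h1 := hg _ (hmem 1)
  have h2 := hg _ (hmem (-1))
  rw [hG, Matrix.mul_smul, trace_smul, trace_mul_vecMulVec] at h1 h2
  rw [hG, trace_mul_vecMulVec] at h0
  rw [Complex.nonneg_iff]
  refine ⟨h0, ?_⟩
  simp at h1 h2
  linarith

end Matrix

/-- The M. Riesz extension theorem, restated for a functional defined on the whole space but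
nonnegative only on the part of the cone in `D`. -/
theorem exists_extension_nonneg {E : Type*} [AddCommGroup E] [Module ℝ E] (s : PointedCone ℝ E)
    (D : Submodule ℝ E) (L : E →ₗ[ℝ] ℝ) (nonneg : ∀ x ∈ D, x ∈ s → 0 ≤ L x)
    (dense : ∀ y, ∃ x ∈ D, x + y ∈ s) :
    ∃ g : E →ₗ[ℝ] ℝ, (∀ x ∈ D, g x = L x) ∧ ∀ x ∈ s, 0 ≤ g x := by
  obtain ⟨g, hg, hs⟩ := riesz_extension s (L.toPMap D) (fun x hx => nonneg x x.2 hx)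
    (fun y => let ⟨x, hx, h⟩ := dense y; ⟨⟨x, hx⟩, h⟩)
  exact ⟨g, fun x hx => hg ⟨x, hx⟩, hs⟩

/-! ### Partial traces, partial transposes and Choi matrices. -/

namespace BroadcastCode

section PartialTrace

variable {ι κ : Type*}

theorem transposeSnd_add (X Y : Op (ι × κ)) :
    transposeSnd (X + Y) = transposeSnd X + transposeSnd Y := rfl

theorem transposeSnd_sub (X Y : Op (ι × κ)) :
    transposeSnd (X - Y) = transposeSnd X - transposeSnd Y := rfl

theorem transposeSnd_smul (c : ℂ) (X : Op (ι × κ)) :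
    transposeSnd (c • X) = c • transposeSnd X := rfl

theorem transposeSnd_zero : transposeSnd (0 : Op (ι × κ)) = 0 := rfl

theorem transposeSnd_conjTranspose (X : Op (ι × κ)) :
    transposeSnd X.conjTranspose = (transposeSnd X).conjTranspose := rfl

theorem transposeSnd_one [DecidableEq ι] [DecidableEq κ] :
    transposeSnd (1 : Op (ι × κ)) = 1 := by
  ext p q
  simp only [transposeSnd, Matrix.of_apply, Matrix.one_apply, Prod.ext_iff]
  congr 1
  rw [eq_comm (a := p.2)]

theorem traceFst_add [Fintype ι] (X Y : Op (ι × κ)) :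
    traceFst (X + Y) = traceFst X + traceFst Y := by
  ext k l
  simp [traceFst, Finset.sum_add_distrib]

theorem traceFst_sub [Fintype ι] (X Y : Op (ι × κ)) :
    traceFst (X - Y) = traceFst X - traceFst Y := by
  ext k l
  simp [traceFst, Finset.sum_sub_distrib]

theorem traceFst_smul [Fintype ι] (c : ℂ) (X : Op (ι × κ)) :
    traceFst (c • X) = c • traceFst X := by
  ext k l
  simp [traceFst, Finset.mul_sum]

theorem traceFst_conjTranspose [Fintype ι] (X : Op (ι × κ)) :
    traceFst X.conjTranspose = (traceFst X).conjTranspose := by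
  ext k l
  simp [traceFst]

theorem traceFst_one_kronecker [Fintype ι] [DecidableEq ι] (W : Op κ) :
    traceFst ((1 : Op ι) ⊗ₖ W) = (Fintype.card ι : ℂ) • W := by
  ext k l
  simp [traceFst]

theorem traceSnd_add [Fintype κ] (X Y : Op (ι × κ)) :
    traceSnd (X + Y) = traceSnd X + traceSnd Y := by
  ext k l
  simp [traceSnd, Finset.sum_add_distrib]

theorem trace_traceFst [Fintype ι] [Fintype κ] (X : Op (ι × κ)) :
    (traceFst X).trace = X.trace := by
  simp only [Matrix.trace, traceFst, Matrix.diag_apply, Matrix.of_apply, Fintype.sum_prod_type]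
  exact Finset.sum_comm

theorem trace_traceSnd [Fintype ι] [Fintype κ] (X : Op (ι × κ)) :
    (traceSnd X).trace = X.trace := by
  simp [Matrix.trace, traceSnd, Fintype.sum_prod_type]

theorem posSemidef_traceFst [Fintype ι] {X : Op (ι × κ)} (hX : X.PosSemidef) :
    (traceFst X).PosSemidef := by
  have : traceFst X = ∑ i, X.submatrix (fun k => (i, k)) (fun k => (i, k)) := by
    ext k l
    simp [traceFst, Matrix.sum_apply]
  rw [this]
  exact Matrix.posSemidef_sum _ fun i _ => hX.submatrix _

theorem posSemidef_traceSnd [Fintype κ] {X : Op (ι × κ)} (hX : X.PosSemidef) :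
    (traceSnd X).PosSemidef := by
  have : traceSnd X = ∑ k, X.submatrix (fun i => (i, k)) (fun i => (i, k)) := by
    ext k l
    simp [traceSnd, Matrix.sum_apply]
  rw [this]
  exact Matrix.posSemidef_sum _ fun i _ => hX.submatrix _

variable [Fintype ι] [Fintype κ]

theorem trace_transposeSnd_mul (X Y : Op (ι × κ)) :
    (transposeSnd X * Y).trace = (X * transposeSnd Y).trace := by
  simp only [Matrix.trace, Matrix.diag_apply, Matrix.mul_apply, transposeSnd, Matrix.of_apply,
    Fintype.sum_prod_type]
  refine Finset.sum_congr rfl fun i _ => ?_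
  rw [Finset.sum_comm]
  conv_rhs => rw [Finset.sum_comm]
  exact Finset.sum_congr rfl fun j _ => Finset.sum_comm

theorem trace_kronecker_one_mul [DecidableEq κ] (ρ : Op ι) (Y : Op (ι × κ)) :
    ((ρ ⊗ₖ (1 : Op κ)) * Y).trace = (ρ * traceSnd Y).trace := by
  simp only [Matrix.trace, Matrix.diag_apply, Matrix.mul_apply, Matrix.kroneckerMap_apply,
    Matrix.one_apply, mul_ite, mul_one, mul_zero, ite_mul, zero_mul, Fintype.sum_prod_type,
    Finset.sum_ite_eq, Finset.mem_univ, if_true, traceSnd, Matrix.of_apply, Finset.mul_sum]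
  exact Finset.sum_congr rfl fun i _ => Finset.sum_comm

theorem trace_mul_one_kronecker [DecidableEq ι] (R : Op (ι × κ)) (W : Op κ) :
    (R * ((1 : Op ι) ⊗ₖ W)).trace = (traceFst R * W).trace := by
  rw [Matrix.trace_mul_comm, Matrix.trace_mul_comm (traceFst R)]
  simp only [Matrix.trace, Matrix.diag_apply, Matrix.mul_apply, Matrix.kroneckerMap_apply,
    Matrix.one_apply, ite_mul, one_mul, zero_mul, Fintype.sum_prod_type,
    traceFst, Matrix.of_apply, Finset.mul_sum]
  rw [Finset.sum_comm]
  refine Finset.sum_congr rfl fun k _ => ?_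
  conv_lhs =>
    enter [2, i]
    rw [Finset.sum_comm]
  simp only [Finset.sum_ite_eq, Finset.mem_univ, if_true]
  exact Finset.sum_comm

end PartialTrace

section Choi

variable {ι o : Type*}

theorem choi_apply [DecidableEq ι] (Φ : Op ι →ₗ[ℂ] Op o) (p q : ι × o) :
    choi Φ p q = Φ (Matrix.single p.1 q.1 1) p.2 q.2 := by
  simp only [choi, idTensor, maxEnt, Matrix.of_apply]
  rfl

theorem posSemidef_maxEnt [Fintype ι] [DecidableEq ι] : (maxEnt ι).PosSemidef := by
  have : maxEnt ι = Matrix.vecMulVec (fun p : ι × ι => if p.1 = p.2 then (1 : ℂ) else 0)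
      (star fun p : ι × ι => if p.1 = p.2 then (1 : ℂ) else 0) := by
    ext p q
    simp only [maxEnt, Matrix.vecMulVec_apply, Matrix.of_apply, Pi.star_apply]
    by_cases h : p.1 = p.2 <;> by_cases h' : q.1 = q.2 <;> simp [h, h']
  rw [this]
  exact Matrix.posSemidef_vecMulVec_self_star _

theorem IsChannel.posSemidef_choi [Fintype ι] [Fintype o] [DecidableEq ι] {Φ : Op ι →ₗ[ℂ] Op o}
    (h : IsChannel Φ) :
    (choi Φ).PosSemidef := by
  -- Complete positivity is stated only for reference systems `Fin k`, so the reference copy is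
  -- relabelled.
  let e := Fintype.equivFin ι
  have h1 := h.completelyPositive (Fintype.card ι)
    ((maxEnt ι).submatrix (Prod.map e.symm id) (Prod.map e.symm id)) (posSemidef_maxEnt.submatrix _)
  convert h1.submatrix (Prod.map e id) using 1
  ext p q
  simp [choi, idTensor]

theorem IsChannel.trace_choi [Fintype ι] [Fintype o] [DecidableEq ι] {Φ : Op ι →ₗ[ℂ] Op o}
    (h : IsChannel Φ) :
    (choi Φ).trace = Fintype.card ι := by
  have : ∀ i : ι, ∑ x, Φ (Matrix.single i i 1) x x = 1 := fun i => by
    have := h.tracePreserving (Matrix.single i i 1)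
    rwa [Matrix.trace_single_eq_same] at this
  simp [Matrix.trace, choi_apply, Fintype.sum_prod_type, this]

end Choi

end BroadcastCode

/-! ### The primal program: compactness, attainment and weak duality. -/

namespace BroadcastCode

section Program

theorem trace_transposeSnd {ι κ : Type*} [Fintype ι] [Fintype κ] (X : Op (ι × κ)) :
    (transposeSnd X).trace = X.trace := rfl

variable {A' B C : Type*} [Fintype A'] [DecidableEq B] [DecidableEq C]

theorem PrimalFeasible.m_nonneg [Nonempty B] [Nonempty C] {R : Op (A' × B × C)} {ρ : Op A'}
    {m : ℝ} (h : PrimalFeasible R ρ m) : 0 ≤ m := by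
  obtain ⟨x⟩ := (inferInstance : Nonempty (B × C))
  have := (posSemidef_traceFst h.R_nonneg).diag_nonneg (i := x)
  rw [h.marginal] at this
  simpa using this

/-- This point has objective value 1, because the Choi matrix has trace |A'|; so Γ ≥ 1 > 0. -/
theorem primalFeasible_maximallyMixed [DecidableEq A'] [Nonempty A'] :
    PrimalFeasible (((Fintype.card A' : ℂ)⁻¹) • (1 : Op (A' × B × C)))
      (((Fintype.card A' : ℂ)⁻¹) • (1 : Op A')) 1 where
  R_nonneg := Matrix.PosSemidef.one.smul (by positivity)
  rho_nonneg := Matrix.PosSemidef.one.smul (by positivity)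
  rho_trace := by simp
  marginal := by
    rw [← Matrix.one_kronecker_one, traceFst_smul, traceFst_one_kronecker, smul_smul]
    simp
  lower := by
    rw [transposeSnd_smul, transposeSnd_one, Matrix.smul_kronecker, Matrix.one_kronecker_one,
      sub_neg_eq_add]
    exact (Matrix.PosSemidef.one.smul (by positivity)).add
      (Matrix.PosSemidef.one.smul (by positivity))
  upper := by
    rw [transposeSnd_smul, transposeSnd_one, Matrix.smul_kronecker, Matrix.one_kronecker_one,
      sub_self]
    exact .zero

variable [Fintype B] [Fintype C]

theorem PrimalFeasible.trace_eq {R : Op (A' × B × C)} {ρ : Op A'} {m : ℝ}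
    (h : PrimalFeasible R ρ m) : R.trace.re = m * Fintype.card (B × C) := by
  rw [← trace_traceFst, h.marginal, Matrix.trace_smul, Matrix.trace_one, smul_eq_mul,
    Complex.re_ofReal_mul, Complex.natCast_re]

theorem PrimalFeasible.trace_le {R : Op (A' × B × C)} {ρ : Op A'} {m : ℝ}
    (h : PrimalFeasible R ρ m) : R.trace.re ≤ Fintype.card (B × C) := by
  have := (Complex.nonneg_iff.mp h.upper.trace_nonneg).1
  rw [Matrix.trace_sub, trace_transposeSnd, Matrix.trace_kronecker, h.rho_trace, one_mul,
    Matrix.trace_one, Complex.sub_re, Complex.natCast_re] at this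
  linarith

theorem PrimalFeasible.m_le [Nonempty B] [Nonempty C] {R : Op (A' × B × C)} {ρ : Op A'}
    {m : ℝ} (h : PrimalFeasible R ρ m) : m ≤ Fintype.card (B × C) := by
  have h1 : (1 : ℝ) ≤ Fintype.card (B × C) := by exact_mod_cast Fintype.card_pos
  have h2 := h.trace_eq ▸ h.trace_le
  nlinarith [h.m_nonneg]

theorem continuous_transposeSnd {ι κ : Type*} :
    Continuous (transposeSnd : Op (ι × κ) → Op (ι × κ)) :=
  continuous_matrix fun p q => continuous_id.matrix_elem (p.1, q.2) (q.1, p.2)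

theorem continuous_traceFst {ι κ : Type*} [Fintype ι] :
    Continuous (traceFst : Op (ι × κ) → Op κ) :=
  continuous_matrix fun k l =>
    continuous_finsetSum _ fun i _ => continuous_id.matrix_elem (i, k) (i, l)

theorem continuous_kronecker_one {ι κ : Type*} [DecidableEq κ] :
    Continuous fun ρ : Op ι => ρ ⊗ₖ (1 : Op κ) :=
  continuous_matrix fun p q => (continuous_id.matrix_elem p.1 q.1).mul continuous_const

theorem isCompact_setOf_norm_apply_le {n : Type*} (c : ℝ) :
    IsCompact {X : Op n | ∀ i j, ‖X i j‖ ≤ c} := by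
  have h := isCompact_univ_pi (X := fun _ : n => n → ℂ) fun _ : n =>
    isCompact_univ_pi fun _ : n => isCompact_closedBall (0 : ℂ) c
  have hs : {X : Op n | ∀ i j, ‖X i j‖ ≤ c} =
      Set.pi Set.univ fun _ => Set.pi Set.univ fun _ => Metric.closedBall (0 : ℂ) c :=
    Set.ext fun X => ⟨fun h i _ j _ => by simpa using h i j,
      fun h i j => by simpa using h i trivial j trivial⟩
  rw [hs]
  exact h

theorem isClosed_primalFeasible :
    IsClosed {x : Op (A' × B × C) × Op A' × ℝ | PrimalFeasible x.1 x.2.1 x.2.2} := by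
  have h1 : Continuous fun x : Op (A' × B × C) × Op A' × ℝ => transposeSnd x.1 :=
    continuous_transposeSnd.comp continuous_fst
  have h2 : Continuous fun x : Op (A' × B × C) × Op A' × ℝ => x.2.1 ⊗ₖ (1 : Op (B × C)) :=
    continuous_kronecker_one.comp continuous_snd.fst
  have h3 : Continuous fun x : Op (A' × B × C) × Op A' × ℝ => traceFst x.1 :=
    continuous_traceFst.comp continuous_fst
  have hs : {x : Op (A' × B × C) × Op A' × ℝ | PrimalFeasible x.1 x.2.1 x.2.2} =
      {x | x.1.PosSemidef} ∩ {x | x.2.1.PosSemidef} ∩ {x | x.2.1.trace = 1} ∩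
      {x | traceFst x.1 = (x.2.2 : ℂ) • (1 : Op (B × C))} ∩
      {x | (transposeSnd x.1 - -(x.2.1 ⊗ₖ (1 : Op (B × C)))).PosSemidef} ∩
      {x | (x.2.1 ⊗ₖ (1 : Op (B × C)) - transposeSnd x.1).PosSemidef} :=
    Set.ext fun x => ⟨fun h => ⟨⟨⟨⟨⟨h.1, h.2⟩, h.3⟩, h.4⟩, h.5⟩, h.6⟩,
      fun h => ⟨h.1.1.1.1.1, h.1.1.1.1.2, h.1.1.1.2, h.1.1.2, h.1.2, h.2⟩⟩
  rw [hs]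
  refine .inter (.inter (.inter (.inter (.inter ?_ ?_) ?_) ?_) ?_) ?_
  · exact Matrix.isClosed_setOf_posSemidef.preimage continuous_fst
  · exact Matrix.isClosed_setOf_posSemidef.preimage continuous_snd.fst
  · exact isClosed_eq (by fun_prop) continuous_const
  · exact isClosed_eq h3 (by fun_prop)
  · exact Matrix.isClosed_setOf_posSemidef.preimage (h1.sub h2.neg)
  · exact Matrix.isClosed_setOf_posSemidef.preimage (h2.sub h1)

theorem isCompact_primalFeasible [Nonempty B] [Nonempty C] :
    IsCompact {x : Op (A' × B × C) × Op A' × ℝ | PrimalFeasible x.1 x.2.1 x.2.2} := by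
  refine IsCompact.of_isClosed_subset
    ((isCompact_setOf_norm_apply_le (Fintype.card (B × C))).prod
      ((isCompact_setOf_norm_apply_le 1).prod
      (isCompact_Icc (a := (0 : ℝ)) (b := Fintype.card (B × C))))) isClosed_primalFeasible ?_
  rintro ⟨R, ρ, m⟩ h
  change PrimalFeasible R ρ m at h
  refine ⟨fun i j => (h.R_nonneg.norm_apply_le_trace i j).trans h.trace_le, fun i j => ?_,
    h.m_nonneg, h.m_le⟩
  simpa [h.rho_trace] using h.rho_nonneg.norm_apply_le_trace i j

variable [DecidableEq A'] {N : Op A' →ₗ[ℂ] Op (B × C)}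

theorem one_mem_primalValues [Nonempty A'] (hN : IsChannel N) : 1 ∈ primalValues N := by
  refine ⟨_, _, _, primalFeasible_maximallyMixed, ?_⟩
  simp [hN.trace_choi]

theorem isCompact_primalValues [Nonempty B] [Nonempty C] : IsCompact (primalValues N) := by
  convert isCompact_primalFeasible.image (f := fun x : Op (A' × B × C) × Op A' × ℝ =>
    (x.1 * (choi N).transpose).trace.re) (by fun_prop) using 1
  ext x
  simp [primalValues]

theorem isGreatest_gammaValue [Nonempty A'] [Nonempty B] [Nonempty C] (hN : IsChannel N) :
    IsGreatest (primalValues N) (gammaValue N) :=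
  isCompact_primalValues.isGreatest_sSup ⟨1, one_mem_primalValues hN⟩

theorem gammaValue_pos [Nonempty A'] [Nonempty B] [Nonempty C] (hN : IsChannel N) :
    0 < gammaValue N :=
  zero_lt_one.trans_le ((isGreatest_gammaValue hN).2 (one_mem_primalValues hN))

/-- Each primal constraint is paired with its dual partner; the four traces are nonnegative and add
up to the claim. The leftover term m·Tr W is at most 0 because m ≥ 0. -/
theorem PrimalFeasible.le_of_dualFeasible [Nonempty B] [Nonempty C]
    {R V Y : Op (A' × B × C)} {ρ : Op A'} {m : ℝ} {W : Op (B × C)} {μ : ℝ}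
    (hP : PrimalFeasible R ρ m) (hD : DualFeasible N V Y W μ) :
    (R * (choi N).transpose).trace.re ≤ μ := by
  have h1 := hP.R_nonneg.re_trace_mul_nonneg hD.dominates
  have h2 := hP.lower.re_trace_mul_nonneg hD.Y_nonneg
  have h3 := hP.upper.re_trace_mul_nonneg hD.V_nonneg
  have h4 := hP.rho_nonneg.re_trace_mul_nonneg hD.bound
  rw [Matrix.mul_sub, Matrix.mul_add, Matrix.trace_sub, Matrix.trace_add,
    ← trace_transposeSnd_mul, Matrix.mul_sub, trace_mul_one_kronecker, hP.marginal,
      Matrix.smul_mul, Matrix.one_mul,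
    Matrix.trace_smul, Matrix.trace_sub, Complex.sub_re, Complex.add_re, Complex.sub_re,
    smul_eq_mul, Complex.re_ofReal_mul] at h1
  rw [sub_neg_eq_add, Matrix.add_mul, Matrix.trace_add, trace_kronecker_one_mul, Complex.add_re]
    at h2
  rw [Matrix.sub_mul, Matrix.trace_sub, trace_kronecker_one_mul, Complex.sub_re] at h3
  rw [traceSnd_add, Matrix.mul_sub, Matrix.mul_add, Matrix.trace_sub, Matrix.trace_add,
    Matrix.mul_smul, Matrix.mul_one,
    Matrix.trace_smul, hP.rho_trace, Complex.sub_re, Complex.add_re] at h4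
  have h5 := mul_nonpos_of_nonneg_of_nonpos hP.m_nonneg hD.W_trace
  simp at h4
  linarith

end Program

end BroadcastCode

/-! ### Strong duality and attainment of the dual minimum. -/

namespace BroadcastCode

section StrongDuality

variable {A' B C : Type*} [Fintype A'] [Fintype B] [Fintype C]
  [DecidableEq A'] [DecidableEq B] [DecidableEq C]

/-- The primal bound, without the normalization of `ρ`. -/
theorem re_trace_le_gammaValue_mul [Nonempty A'] [Nonempty B] [Nonempty C]
    {N : Op A' →ₗ[ℂ] Op (B × C)} (hN : IsChannel N) {R : Op (A' × B × C)} {ρ : Op A'} {m : ℝ}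
    (hR : R.PosSemidef) (hρ : ρ.PosSemidef) (hm : traceFst R = (m : ℂ) • (1 : Op (B × C)))
    (hl : (ρ ⊗ₖ (1 : Op (B × C)) + transposeSnd R).PosSemidef)
    (hu : (ρ ⊗ₖ (1 : Op (B × C)) - transposeSnd R).PosSemidef) :
    (R * (choi N).transpose).trace.re ≤ gammaValue N * ρ.trace.re := by
  obtain ⟨ht, hi⟩ := Complex.nonneg_iff.mp hρ.trace_nonneg
  have hρt : ρ.trace = (ρ.trace.re : ℂ) := Complex.ext rfl (by simp [← hi])
  -- If Tr ρ = 0, the trace of the upper constraint forces Tr R = 0, hence R = 0. Otherwise divide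
  -- everything by Tr ρ.
  rcases ht.eq_or_lt with h0 | hpos
  · have h1 := (Complex.nonneg_iff.mp hu.trace_nonneg).1
    have h2 := Complex.nonneg_iff.mp hR.trace_nonneg
    rw [Matrix.trace_sub, Matrix.trace_kronecker, hρt, ← h0, trace_transposeSnd] at h1
    simp only [Complex.ofReal_zero, zero_mul, zero_sub, Complex.neg_re] at h1
    have : R = 0 := hR.trace_eq_zero_iff.mp
      (Complex.ext (le_antisymm (by simpa using h1) h2.1) h2.2.symm)
    simp [this, ← h0]
  · set t := ρ.trace.re
    have hc : (0 : ℂ) ≤ ((t⁻¹ : ℝ) : ℂ) := by exact_mod_cast (inv_pos.mpr hpos).le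
    have hf : PrimalFeasible (((t⁻¹ : ℝ) : ℂ) • R) (((t⁻¹ : ℝ) : ℂ) • ρ) (t⁻¹ * m) := by
      refine ⟨hR.smul hc, hρ.smul hc, ?_, ?_, ?_, ?_⟩
      · rw [Matrix.trace_smul, hρt, smul_eq_mul, ← Complex.ofReal_mul, inv_mul_cancel₀ hpos.ne',
          Complex.ofReal_one]
      · rw [traceFst_smul, hm, smul_smul, Complex.ofReal_mul]
      · rw [sub_neg_eq_add, add_comm, transposeSnd_smul, Matrix.smul_kronecker, ← smul_add]
        exact hl.smul hc
      · rw [transposeSnd_smul, Matrix.smul_kronecker, ← smul_sub]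
        exact hu.smul hc
    have := (isGreatest_gammaValue hN).2 ⟨_, _, _, hf, rfl⟩
    rw [Matrix.smul_mul, Matrix.trace_smul, smul_eq_mul, Complex.re_ofReal_mul,
      inv_mul_le_iff₀ hpos] at this
    linarith

theorem re_trace_conjTranspose_mul {n : Type*} [Fintype n] (X : Op n) {H : Op n}
    (hH : H.IsHermitian) : (X.conjTranspose * H).trace.re = (X * H).trace.re := by
  have : X.conjTranspose * H = (H * X).conjTranspose := by
    rw [Matrix.conjTranspose_mul, hH.eq]
  rw [this, Matrix.trace_conjTranspose, Matrix.trace_mul_comm]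
  simp

/-- The matrices `(R, ρ, ρ ⊗ 1 + R^T, ρ ⊗ 1 - R^T)` such that the marginal of `R` is a multiple
of the identity. -/
def primalSubspace (A' B C : Type*) [Fintype A'] [DecidableEq B] [DecidableEq C] :
    Submodule ℝ (Op (A' × B × C) × Op A' × Op (A' × B × C) × Op (A' × B × C)) where
  carrier := {x | (∃ m : ℂ, traceFst x.1 = m • (1 : Op (B × C))) ∧
    x.2.2.1 = x.2.1 ⊗ₖ (1 : Op (B × C)) + transposeSnd x.1 ∧
    x.2.2.2 = x.2.1 ⊗ₖ (1 : Op (B × C)) - transposeSnd x.1}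
  add_mem' := by
    rintro ⟨R, ρ, S, T⟩ ⟨R', ρ', S', T'⟩ ⟨⟨m, hm⟩, hS, hT⟩ ⟨⟨m', hm'⟩, hS', hT'⟩
    dsimp only at hm hS hT hm' hS' hT'
    refine ⟨⟨m + m', ?_⟩, ?_, ?_⟩
    · simp [traceFst_add, hm, hm', add_smul]
    · simp only [Prod.mk_add_mk, hS, hS', Matrix.add_kronecker, transposeSnd_add]
      abel
    · simp only [Prod.mk_add_mk, hT, hT', Matrix.add_kronecker, transposeSnd_add]
      abel
  zero_mem' := ⟨⟨0, by ext; simp [traceFst]⟩, by simp [transposeSnd_zero],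
    by simp [transposeSnd_zero]⟩
  smul_mem' := by
    rintro c ⟨R, ρ, S, T⟩ ⟨⟨m, hm⟩, hS, hT⟩
    dsimp only at hm hS hT
    refine ⟨⟨c * m, ?_⟩, ?_, ?_⟩
    · simp only [Prod.smul_mk, ← Complex.coe_smul, traceFst_smul, hm, smul_smul]
    · simp only [Prod.smul_mk, ← Complex.coe_smul, hS, transposeSnd_smul, Matrix.smul_kronecker,
      smul_add]
    · simp only [Prod.smul_mk, ← Complex.coe_smul, hT, transposeSnd_smul, Matrix.smul_kronecker,
      smul_sub]

/-- The real functional `X ↦ re Tr (X H)`. -/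
def reTraceMul {n : Type*} [Fintype n] (H : Op n) : Op n →ₗ[ℝ] ℝ where
  toFun X := (X * H).trace.re
  map_add' X Y := by simp [Matrix.add_mul]
  map_smul' c X := by simp

theorem eq_zero_of_re_trace_conjTranspose_mul_self {n : Type*} [Fintype n] {X : Op n}
    (h : (X.conjTranspose * X).trace.re = 0) : X = 0 := by
  have h1 := Complex.nonneg_iff.mp (Matrix.posSemidef_conjTranspose_mul_self X).trace_nonneg
  exact Matrix.trace_conjTranspose_mul_self_eq_zero_iff.mp (Complex.ext h h1.2.symm)

/-- The Riesz extension, split over the four factors. The resulting identity holds for arbitrary,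
not only Hermitian, R and ρ, so coefficients can later be compared freely. -/
theorem exists_nonneg_functional [Nonempty A'] [Nonempty B] [Nonempty C]
    {N : Op A' →ₗ[ℂ] Op (B × C)} (hN : IsChannel N) :
    ∃ (P : Op (A' × B × C)) (σ : Op A') (Y V : Op (A' × B × C)),
      P.PosSemidef ∧ σ.PosSemidef ∧ Y.PosSemidef ∧ V.PosSemidef ∧
      ∀ (R : Op (A' × B × C)) (ρ : Op A') (m : ℂ), traceFst R = m • (1 : Op (B × C)) →
        gammaValue N * ρ.trace.re - (R * (choi N).transpose).trace.re =
          (P * R).trace.re + (σ * ρ).trace.re +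
          (Y * (ρ ⊗ₖ (1 : Op (B × C)) + transposeSnd R)).trace.re +
          (V * (ρ ⊗ₖ (1 : Op (B × C)) - transposeSnd R)).trace.re := by
  let L : (Op (A' × B × C) × Op A' × Op (A' × B × C) × Op (A' × B × C)) →ₗ[ℝ] ℝ :=
    gammaValue N • (reTraceMul 1 ∘ₗ LinearMap.fst ℝ _ _ ∘ₗ LinearMap.snd ℝ _ _) -
      reTraceMul (choi N).transpose ∘ₗ LinearMap.fst ℝ _ _
  have hL : ∀ R ρ S T, L (R, ρ, S, T) =
      gammaValue N * ρ.trace.re - (R * (choi N).transpose).trace.re := by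
    intro R ρ S T
    simp [L, reTraceMul]
  let s : PointedCone ℝ (Op (A' × B × C) × Op A' × Op (A' × B × C) × Op (A' × B × C)) :=
    (Matrix.accretiveCone (A' × B × C)).prod ((Matrix.accretiveCone A').prod
      ((Matrix.accretiveCone (A' × B × C)).prod (Matrix.accretiveCone (A' × B × C))))
  have hLs : ∀ x ∈ primalSubspace A' B C, x ∈ s → 0 ≤ L x := by
    rintro ⟨R, ρ, S, T⟩ ⟨⟨m, hm⟩, hS, hT⟩ ⟨hR, hρ, hS', hT'⟩
    dsimp only at hm hS hT
    change R ∈ Matrix.accretiveCone _ at hR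
    change ρ ∈ Matrix.accretiveCone _ at hρ
    change S ∈ Matrix.accretiveCone _ at hS'
    change T ∈ Matrix.accretiveCone _ at hT'
    have hk : (ρ ⊗ₖ (1 : Op (B × C))).conjTranspose = ρ.conjTranspose ⊗ₖ (1 : Op (B × C)) := by
      rw [Matrix.conjTranspose_kronecker, Matrix.conjTranspose_one]
    -- Pass to twice the Hermitian parts, which are feasible up to normalization; the functional
    -- doubles. The marginal coefficient becomes m + m̄ = 2 Re m.
    have key := re_trace_le_gammaValue_mul hN (R := R + R.conjTranspose)
      (ρ := ρ + ρ.conjTranspose) (m := 2 * m.re) hR hρ ?_ ?_ ?_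
    · rw [Matrix.add_mul, Matrix.trace_add, Complex.add_re,
        re_trace_conjTranspose_mul R hN.posSemidef_choi.transpose.1, Matrix.trace_add,
        Matrix.trace_conjTranspose, Complex.add_re] at key
      simp only [RCLike.star_def, Complex.conj_re] at key
      rw [hL]
      linarith
    · rw [traceFst_add, traceFst_conjTranspose, hm, Matrix.conjTranspose_smul,
        Matrix.conjTranspose_one, ← add_smul]
      congr 1
      apply Complex.ext <;> simp; ring
    · rw [Matrix.mem_accretiveCone] at hS'
      convert hS' using 1
      rw [hS, Matrix.conjTranspose_add, hk, Matrix.add_kronecker, transposeSnd_add,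
        transposeSnd_conjTranspose]
      abel
    · rw [Matrix.mem_accretiveCone] at hT'
      convert hT' using 1
      rw [hT, Matrix.conjTranspose_sub, hk, Matrix.add_kronecker, transposeSnd_add,
        transposeSnd_conjTranspose]
      abel
  have hdense : ∀ y, ∃ x ∈ primalSubspace A' B C, x + y ∈ s := by
    rintro ⟨R, ρ, S, T⟩
    obtain ⟨a, ha⟩ := Matrix.exists_smul_one_add_mem_accretiveCone R
    obtain ⟨b, hb⟩ := Matrix.exists_smul_one_add_mem_accretiveCone ρ
    obtain ⟨c, hc⟩ := Matrix.exists_smul_one_add_mem_accretiveCone S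
    obtain ⟨d, hd⟩ := Matrix.exists_smul_one_add_mem_accretiveCone T
    obtain ⟨t, h0, hta, htb, htc, htd⟩ : ∃ t : ℝ, 0 ≤ t ∧ a ≤ t ∧ b ≤ t ∧ c ≤ t ∧ d ≤ t :=
      ⟨max 0 (max a (max b (max c d))), by simp, by simp, by simp, by simp, by simp⟩
    -- The interior point is R = t·1, ρ = 2t·1; then ρ⊗1 ± R^{T_BC} are 3t·1 and t·1.
    refine ⟨((t : ℂ) • 1, ((2 * t : ℝ) : ℂ) • 1, ((3 * t : ℝ) : ℂ) • 1, (t : ℂ) • 1),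
      ⟨⟨t * Fintype.card A', ?_⟩, ?_, ?_⟩, ha t hta, hb _ (by linarith), hc _ (by linarith),
        hd t htd⟩
    · rw [← Matrix.one_kronecker_one, traceFst_smul, traceFst_one_kronecker, smul_smul]
    · rw [transposeSnd_smul, transposeSnd_one, Matrix.smul_kronecker, Matrix.one_kronecker_one,
        ← add_smul]
      dsimp only
      congr 1; push_cast; ring
    · rw [transposeSnd_smul, transposeSnd_one, Matrix.smul_kronecker, Matrix.one_kronecker_one,
        ← sub_smul]
      dsimp only
      congr 1; push_cast; ring
  obtain ⟨g, hg, hs⟩ := exists_extension_nonneg s (primalSubspace A' B C) L hLs hdense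
  obtain ⟨P, hP, hgP⟩ := Matrix.exists_posSemidef_of_nonneg (g ∘ₗ LinearMap.inl ℝ _ _)
    fun X hX => hs _ ⟨hX, zero_mem _⟩
  obtain ⟨σ, hσ, hgσ⟩ := Matrix.exists_posSemidef_of_nonneg
    (g ∘ₗ LinearMap.inr ℝ _ _ ∘ₗ LinearMap.inl ℝ _ _)
    fun X hX => hs _ ⟨zero_mem _, hX, zero_mem _⟩
  obtain ⟨Y, hY, hgY⟩ := Matrix.exists_posSemidef_of_nonneg
    (g ∘ₗ LinearMap.inr ℝ _ _ ∘ₗ LinearMap.inr ℝ _ _ ∘ₗ LinearMap.inl ℝ _ _)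
    fun X hX => hs _ ⟨zero_mem _, zero_mem _, hX, zero_mem _⟩
  obtain ⟨V, hV, hgV⟩ := Matrix.exists_posSemidef_of_nonneg
    (g ∘ₗ LinearMap.inr ℝ _ _ ∘ₗ LinearMap.inr ℝ _ _ ∘ₗ LinearMap.inr ℝ _ _)
    fun X hX => hs _ ⟨zero_mem _, zero_mem _, zero_mem _, hX⟩
  refine ⟨P, σ, Y, V, hP, hσ, hY, hV, fun R ρ m hm => ?_⟩
  rw [← hL R ρ (ρ ⊗ₖ 1 + transposeSnd R) (ρ ⊗ₖ 1 - transposeSnd R),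
    ← hg _ ⟨⟨m, hm⟩, rfl, rfl⟩, ← hgP, ← hgσ, ← hgY, ← hgV]
  simp only [LinearMap.comp_apply, LinearMap.inl_apply, LinearMap.inr_apply, ← map_add]
  simp

/-- The operators with zero marginal have the operators 1⊗W as orthogonal complement: X - 1⊗W has
zero marginal, so its adjoint is a legitimate test operator and its norm vanishes. -/
theorem eq_one_kronecker_of_re_trace_mul_eq_zero [Nonempty A'] {X : Op (A' × B × C)}
    (h : ∀ R : Op (A' × B × C), traceFst R = 0 → (R * X).trace.re = 0) :
    X = (1 : Op A') ⊗ₖ ((Fintype.card A' : ℂ)⁻¹ • traceFst X) := by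
  set W : Op (B × C) := (Fintype.card A' : ℂ)⁻¹ • traceFst X with hW
  have h0 : traceFst (X - (1 : Op A') ⊗ₖ W) = 0 := by
    rw [traceFst_sub, traceFst_one_kronecker, hW, smul_smul]
    simp
  have h1 : traceFst (X - (1 : Op A') ⊗ₖ W).conjTranspose = 0 := by
    rw [traceFst_conjTranspose, h0, Matrix.conjTranspose_zero]
  rw [← sub_eq_zero]
  apply eq_zero_of_re_trace_conjTranspose_mul_self
  rw [Matrix.mul_sub, Matrix.trace_sub, trace_mul_one_kronecker, h1, Complex.sub_re, h _ h1]
  simp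

theorem exists_dualFeasible_gammaValue [Nonempty A'] [Nonempty B] [Nonempty C]
    {N : Op A' →ₗ[ℂ] Op (B × C)} (hN : IsChannel N) :
    ∃ V Y W, DualFeasible N V Y W (gammaValue N) := by
  obtain ⟨P, σ, Y, V, hP, hσ, hY, hV, h⟩ := exists_nonneg_functional hN
  -- X will be 1⊗W, with P the slack of the domination constraint. The identity at ρ = 0 makes X
  -- orthogonal to every R with marginal proportional to 1.
  set X : Op (A' × B × C) := (choi N).transpose + P - transposeSnd (V - Y) with hX
  have hX' : ∀ (R : Op (A' × B × C)) (m : ℂ), traceFst R = m • (1 : Op (B × C)) →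
      (R * X).trace.re = 0 := by
    intro R m hm
    have h1 := h R 0 m hm
    rw [hX, Matrix.mul_sub, Matrix.mul_add, Matrix.trace_sub, Matrix.trace_add,
      ← trace_transposeSnd_mul, Matrix.mul_sub, Matrix.trace_sub, Matrix.trace_mul_comm R P,
      Matrix.trace_mul_comm _ V, Matrix.trace_mul_comm _ Y]
    simp at h1 ⊢
    linarith
  have hXW := eq_one_kronecker_of_re_trace_mul_eq_zero fun R hR => hX' R 0 (by simpa using hR)
  set W : Op (B × C) := (Fintype.card A' : ℂ)⁻¹ • traceFst X with hW
  have hT : ∀ {Z : Op (A' × B × C)}, Z.PosSemidef → (transposeSnd Z).IsHermitian := fun hZ => by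
    rw [Matrix.IsHermitian, ← transposeSnd_conjTranspose, hZ.1.eq]
  have hXh : X.IsHermitian := by
    rw [hX, transposeSnd_sub]
    exact (hN.posSemidef_choi.transpose.1.add hP.1).sub ((hT hV).sub (hT hY))
  -- The identity at R = 0 with ρ arbitrary: σ is the slack of the bound by Γ·1.
  have hσ' : gammaValue N • (1 : Op A') - traceSnd (V + Y) = σ := by
    rw [← sub_eq_zero]
    apply eq_zero_of_re_trace_conjTranspose_mul_self
    set D := gammaValue N • (1 : Op A') - traceSnd (V + Y) - σ with hD
    have h2 := h 0 D.conjTranspose 0 (by ext; simp [traceFst])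
    rw [Matrix.trace_mul_comm σ, transposeSnd_zero, add_zero, sub_zero, Matrix.trace_mul_comm Y,
      Matrix.trace_mul_comm V, trace_kronecker_one_mul, trace_kronecker_one_mul] at h2
    change (D.conjTranspose * (gammaValue N • (1 : Op A') - traceSnd (V + Y) - σ)).trace.re = 0
    clear_value D
    simp only [Matrix.mul_sub, traceSnd_add, Matrix.mul_add, Matrix.trace_sub, Matrix.trace_add,
      Complex.sub_re, Complex.add_re]
    simp at h2 ⊢
    linarith
  refine ⟨V, Y, W, hV, hY, ?_, ?_, ?_, ?_⟩
  · rw [Matrix.IsHermitian, hW, Matrix.conjTranspose_smul, ← traceFst_conjTranspose, hXh.eq]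
    simp
  -- Testing with R = 1, whose marginal is |A'|·1, gives Tr W = 0.
  · have h3 := hX' 1 (Fintype.card A') (by
      rw [← Matrix.one_kronecker_one, traceFst_one_kronecker])
    rw [Matrix.one_mul] at h3
    rw [hW, Matrix.trace_smul, trace_traceFst, smul_eq_mul, ← Complex.ofReal_natCast,
      ← Complex.ofReal_inv, Complex.re_ofReal_mul, h3, mul_zero]
  · convert hP using 1
    rw [← hXW, hX]
    abel
  · rw [Complex.coe_smul, hσ']
    exact hσ

theorem isLeast_dualValues [Nonempty A'] [Nonempty B] [Nonempty C]
    {N : Op A' →ₗ[ℂ] Op (B × C)} (hN : IsChannel N) :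
    IsLeast (dualValues N) (gammaValue N) := by
  refine ⟨exists_dualFeasible_gammaValue hN, ?_⟩
  rintro μ ⟨V, Y, W, hD⟩
  obtain ⟨R, ρ, m, hP, hv⟩ := (isGreatest_gammaValue hN).1
  exact hv ▸ hP.le_of_dualFeasible hD

end StrongDuality

end BroadcastCode

/-! ### Contractions of positive semidefinite matrices. -/

namespace Matrix

variable {m n K : Type*} [Fintype n]

theorem PosSemidef.sum_sum_apply [Fintype K] [Finite m] {M : Matrix n n ℂ} (hM : M.PosSemidef)
    (e : K → m → n) : (of fun p q => ∑ a, ∑ b, M (e a p) (e b q)).PosSemidef := by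
  have := Fintype.ofFinite m
  obtain ⟨D, rfl⟩ := hM.exists_eq_conjTranspose_mul_self
  convert posSemidef_conjTranspose_mul_self (of fun k p => ∑ a, D k (e a p)) using 1
  ext p q
  simp only [of_apply, mul_apply, conjTranspose_apply, star_sum, Finset.sum_mul_sum]
  symm
  rw [Finset.sum_comm]
  exact Finset.sum_congr rfl fun a _ => Finset.sum_comm

/-- The matrix is the compression of M by the vectors e_{f p} + s e_{g p}, with s = ±1. -/
theorem PosSemidef.four_apply [Finite m] {M : Matrix n n ℂ} (hM : M.PosSemidef)
    (f g : m → n) {s : ℝ} (hs : s * s = 1) :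
    (M.submatrix f f + (s : ℂ) • M.submatrix f g + (s : ℂ) • M.submatrix g f +
      M.submatrix g g).PosSemidef := by
  have := Fintype.ofFinite m
  have hs' : (s : ℂ) * s = 1 := by exact_mod_cast hs
  obtain ⟨D, rfl⟩ := hM.exists_eq_conjTranspose_mul_self
  convert posSemidef_conjTranspose_mul_self (of fun k p => D k (f p) + s * D k (g p)) using 1
  ext p q
  simp only [add_apply, smul_apply, submatrix_apply, mul_apply, conjTranspose_apply, of_apply,
    smul_eq_mul, Finset.mul_sum, ← Finset.sum_add_distrib, star_add, star_mul', RCLike.star_def,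
    Complex.conj_ofReal]
  refine Finset.sum_congr rfl fun k _ => ?_
  linear_combination (-(starRingEnd ℂ) (D k (g p)) * D k (g q)) * hs'

/-- Contracting a positive semidefinite matrix with `1 ± S`, where `S` is the swap. -/
theorem PosSemidef.sum_add_swap [Fintype K] [Finite m] {M : Matrix n n ℂ} (hM : M.PosSemidef)
    (e : K → K → m → n) {s : ℝ} (hs : s * s = 1) :
    (∑ a, ∑ b, (M.submatrix (e a b) (e a b) +
      (s : ℂ) • M.submatrix (e a b) (e b a))).PosSemidef := by
  -- This uses 1 + sS = ½ Σ (|ab⟩ + s|ba⟩)(⟨ab| + s⟨ba|), summed over all a, b.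
  have h := Matrix.posSemidef_sum Finset.univ fun a (_ : a ∈ Finset.univ) =>
    Matrix.posSemidef_sum Finset.univ fun b (_ : b ∈ Finset.univ) =>
      hM.four_apply (e a b) (e b a) hs
  convert h.smul (show (0 : ℝ) ≤ 1 / 2 by norm_num) using 1
  have h1 : ∑ a : K, ∑ b : K, M.submatrix (e b a) (e b a) =
      ∑ a, ∑ b, M.submatrix (e a b) (e a b) := Finset.sum_comm
  have h2 : ∑ a : K, ∑ b : K, (s : ℂ) • M.submatrix (e b a) (e a b) =
      ∑ a, ∑ b, (s : ℂ) • M.submatrix (e a b) (e b a) := Finset.sum_comm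
  simp only [Finset.sum_add_distrib, h1, h2]
  module

end Matrix

/-! ### From codes to primal feasible points. -/

namespace BroadcastCode

theorem traceFst_single {ι κ : Type*} [Fintype ι] [DecidableEq ι] [DecidableEq κ]
    (a b : ι) (k l : κ) :
    traceFst (Matrix.single (a, k) (b, l) (1 : ℂ)) =
      if a = b then Matrix.single k l 1 else 0 := by
  ext x y
  split_ifs with h
  · subst h
    simp [traceFst, Matrix.single_apply, ite_and]
  · simp only [traceFst, Matrix.single_apply, Matrix.of_apply, Prod.mk.injEq, Matrix.zero_apply]
    exact Finset.sum_eq_zero fun i _ => if_neg fun hi => h (hi.1.1.trans hi.2.1.symm)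

theorem traceSnd_single {ι κ : Type*} [Fintype κ] [DecidableEq ι] [DecidableEq κ]
    (a b : ι) (k l : κ) :
    traceSnd (Matrix.single (a, k) (b, l) (1 : ℂ)) =
      if k = l then Matrix.single a b 1 else 0 := by
  ext x y
  split_ifs with h
  · subst h
    simp [traceSnd, Matrix.single_apply, ite_and]
  · simp only [traceSnd, Matrix.single_apply, Matrix.of_apply, Prod.mk.injEq, Matrix.zero_apply]
    exact Finset.sum_eq_zero fun i _ => if_neg fun hi => h (hi.1.2.trans hi.2.2.symm)

section Fidelity

variable {κ : Type*} [Fintype κ] [DecidableEq κ]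

theorem trace_epr_mul_idTensor_epr (Φ : Op κ →ₗ[ℂ] Op κ) :
    (epr κ * idTensor Φ (epr κ)).trace =
      (Fintype.card κ : ℂ)⁻¹ ^ 2 * ∑ a, ∑ b, Φ (Matrix.single a b 1) a b := by
  have h : ∀ p q : κ × κ, idTensor Φ (epr κ) p q =
      (Fintype.card κ : ℂ)⁻¹ * Φ (Matrix.single p.1 q.1 1) p.2 q.2 := by
    intro p q
    rw [← smul_eq_mul, ← Matrix.smul_apply, ← map_smul]
    rfl
  simp only [Matrix.trace, Matrix.diag_apply, Matrix.mul_apply, h]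
  simp only [epr, maxEnt, Matrix.smul_apply, Matrix.of_apply, Fintype.sum_prod_type, ite_and,
    smul_eq_mul, mul_ite, mul_one, mul_zero, ite_mul, zero_mul, Finset.sum_ite_eq, Finset.mem_univ,
    if_true, Finset.sum_const_zero, Finset.sum_ite_irrel]
  rw [Finset.sum_comm, Finset.mul_sum]
  refine Finset.sum_congr rfl fun a _ => ?_
  rw [Finset.mul_sum]
  refine Finset.sum_congr rfl fun b _ => ?_
  ring

end Fidelity

section CodeBound

variable {A' B C : Type*} [Fintype A'] [Fintype B] [Fintype C]
  [DecidableEq B] [DecidableEq C] {r₁ r₂ : ℕ}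

/-- The operator obtained by contracting the Choi matrix of a code with the maximally entangled
vector on Alice's input and the outputs of the receivers. -/
noncomputable def codeOperator (Z : CodeMap A' B C r₁ r₂) : Op (A' × B × C) :=
  ((r₁ * r₂ : ℕ) : ℂ)⁻¹ • Matrix.of fun p q =>
    ∑ a, ∑ b, choi Z ((a, p.2), (p.1, a)) ((b, q.2), (q.1, b))

theorem posSemidef_codeOperator {Z : CodeMap A' B C r₁ r₂} (hZ : IsChannel Z) :
    (codeOperator Z).PosSemidef :=
  (hZ.posSemidef_choi.sum_sum_apply fun (a : Fin r₁ × Fin r₂) (p : A' × B × C) =>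
    ((a, p.2), (p.1, a))).smul (by positivity)

/-- Tracing out A' leaves the receivers' own channel Φ, which sees only the trace of |a⟩⟨b|; the
terms a ≠ b vanish, and the rest add up to a trace preserved by Φ. -/
theorem traceFst_codeOperator [NeZero r₁] [NeZero r₂] {Z : CodeMap A' B C r₁ r₂}
    (hZ : NoSignalAtoBC Z) :
    traceFst (codeOperator Z) = (((r₁ * r₂ : ℕ) : ℝ)⁻¹ : ℝ) • (1 : Op (B × C)) := by
  obtain ⟨Φ, hΦ, h⟩ := hZ
  rw [codeOperator, traceFst_smul, ← Complex.coe_smul, Complex.ofReal_inv, Complex.ofReal_natCast]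
  congr 1
  ext k l
  have h1 : ∀ a b, ∑ i, choi Z ((a, k), (i, a)) ((b, l), (i, b)) =
      if a = b then Φ (Matrix.single k l 1) a b else 0 := by
    intro a b
    have h2 := congrFun₂ (h (Matrix.single (a, k) (b, l) 1)) a b
    rw [traceFst_single] at h2
    simp only [choi_apply]
    refine h2.trans ?_
    split_ifs <;> simp
  have h3 := hΦ.tracePreserving (Matrix.single k l 1)
  calc traceFst (Matrix.of fun p q : A' × B × C =>
        ∑ a, ∑ b, choi Z ((a, p.2), (p.1, a)) ((b, q.2), (q.1, b))) k l
      = ∑ a, ∑ b, ∑ i, choi Z ((a, k), (i, a)) ((b, l), (i, b)) := by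
        simp only [traceFst, Matrix.of_apply]
        rw [Finset.sum_comm]
        exact Finset.sum_congr rfl fun a _ => Finset.sum_comm
    _ = (Φ (Matrix.single k l 1)).trace := by
        simp [h1, Matrix.trace]
    _ = (1 : Op (B × C)) k l := by
        rw [h3]
        by_cases hkl : k = l
        · subst hkl; simp
        · rw [Matrix.trace_single_eq_of_ne _ _ _ hkl, Matrix.one_apply_ne hkl]

/-- Alice's marginal output for the maximally mixed input. -/
noncomputable def codeMarginal (r₁ r₂ : ℕ) (Φ : Op (Fin r₁ × Fin r₂) →ₗ[ℂ] Op A') : Op A' :=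
  ((r₁ * r₂ : ℕ) : ℂ)⁻¹ • Φ 1

/-- The contraction with 1 + sS: the identity part traces out B'C' and yields ρ⊗1 by no signalling
from BC to A, while the swap part is the partially transposed code operator. -/
theorem posSemidef_kronecker_add_transposeSnd_codeOperator
    {Z : CodeMap A' B C r₁ r₂} (hZ : (transposeA (choi Z)).PosSemidef)
    {Φ : Op (Fin r₁ × Fin r₂) →ₗ[ℂ] Op A'} (hΦ : ∀ X, traceSnd (Z X) = Φ (traceSnd X))
    {s : ℝ} (hs : s * s = 1) :
    (codeMarginal r₁ r₂ Φ ⊗ₖ (1 : Op (B × C)) +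
      (s : ℂ) • transposeSnd (codeOperator Z)).PosSemidef := by
  let e : (Fin r₁ × Fin r₂) → (Fin r₁ × Fin r₂) → A' × B × C →
      ((Fin r₁ × Fin r₂) × B × C) × (A' × Fin r₁ × Fin r₂) := fun a b p => ((a, p.2), (p.1, b))
  -- The full transpose of Z^{T_AA'} is the transpose on BCB'C', which matches the transpose on BC
  -- in the program.
  convert (hZ.transpose.sum_add_swap e hs).smul
    (show (0 : ℂ) ≤ ((r₁ * r₂ : ℕ) : ℂ)⁻¹ by positivity) using 1
  rw [codeMarginal, codeOperator, Matrix.smul_kronecker, transposeSnd_smul, smul_comm (s : ℂ),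
    ← smul_add]
  congr 1
  simp only [Finset.sum_add_distrib]
  congr 1
  · ext p q
    have h1 : ∀ a, ∑ b, choi Z ((a, q.2), (p.1, b)) ((a, p.2), (q.1, b)) =
        if q.2 = p.2 then Φ (Matrix.single a a 1) p.1 q.1 else 0 := by
      intro a
      have h2 := congrFun₂ (hΦ (Matrix.single (a, q.2) (a, p.2) 1)) p.1 q.1
      rw [traceSnd_single] at h2
      simp only [choi_apply]
      refine h2.trans ?_
      split_ifs <;> simp
    have h2 : (1 : Op (Fin r₁ × Fin r₂)) = ∑ a, Matrix.single a a 1 := by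
      rw [Matrix.sum_single_one]
    simp only [Matrix.sum_apply]
    refine Eq.trans ?_ (Finset.sum_congr rfl fun a _ => (h1 a).symm)
    rw [h2, map_sum, Matrix.kroneckerMap_apply, Matrix.sum_apply, Matrix.one_apply]
    simp only [eq_comm (a := q.2)]
    split_ifs <;> simp
  · simp only [← Finset.smul_sum]
    congr 1
    ext p q
    simp only [Matrix.sum_apply]
    rfl

end CodeBound

end BroadcastCode

/-! ### The channel fidelity as primal objective value. -/

namespace BroadcastCode

section Fidelity

theorem channelFidelity_eq {A' B C : Type*} [Fintype A'] [DecidableEq A'] {r₁ r₂ : ℕ}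
    (N : Op A' →ₗ[ℂ] Op (B × C)) (Z : CodeMap A' B C r₁ r₂) :
    channelFidelity N Z = (((r₁ * r₂ : ℕ) : ℂ)⁻¹ ^ 2 *
      ∑ a, ∑ b, induced Z N (Matrix.single a b 1) a b).re := by
  rw [channelFidelity, trace_epr_mul_idTensor_epr]
  simp

theorem code_single_kronecker {A' B C : Type*} [Fintype B] [Fintype C] [DecidableEq B]
    [DecidableEq C] {r₁ r₂ : ℕ} (Z : CodeMap A' B C r₁ r₂) (a b : Fin r₁ × Fin r₂)
      (Y : Op (B × C)) :
    Z (Matrix.single a b 1 ⊗ₖ Y) =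
      ∑ x, ∑ y, Y x y • Z (Matrix.single (a, x) (b, y) 1) := by
  have h : Matrix.single a b (1 : ℂ) ⊗ₖ Y =
      ∑ x, ∑ y, Y x y • Matrix.single (a, x) (b, y) (1 : ℂ) := by
    ext ⟨c, x⟩ ⟨d, y⟩
    simp only [Matrix.kroneckerMap_apply, Matrix.sum_apply, Matrix.smul_apply, Matrix.single_apply,
      Prod.mk.injEq, smul_eq_mul]
    by_cases hab : a = c ∧ b = d
    · obtain ⟨rfl, rfl⟩ := hab
      simp [ite_and]
    · rw [if_neg hab, zero_mul, eq_comm]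
      exact Finset.sum_eq_zero fun i _ => Finset.sum_eq_zero fun j _ => by
        rw [if_neg fun h => hab ⟨h.1.1, h.2.1⟩, mul_zero]
  rw [h]
  simp only [map_sum, map_smul]

end Fidelity

section CodeBound

variable {A' B C : Type*} [Fintype A'] [Fintype B] [Fintype C]
  [DecidableEq B] [DecidableEq C] {r₁ r₂ : ℕ}

theorem trace_codeMarginal [NeZero r₁] [NeZero r₂] {Φ : Op (Fin r₁ × Fin r₂) →ₗ[ℂ] Op A'}
    (hΦ : IsChannel Φ) : (codeMarginal r₁ r₂ Φ).trace = 1 := by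
  have h1 : (r₁ : ℂ) ≠ 0 := Nat.cast_ne_zero.mpr (NeZero.ne r₁)
  have h2 : (r₂ : ℂ) ≠ 0 := Nat.cast_ne_zero.mpr (NeZero.ne r₂)
  rw [codeMarginal, Matrix.trace_smul, hΦ.tracePreserving, Matrix.trace_one]
  simp
  field_simp

theorem IsPPTNSCode.exists_primalFeasible [NeZero r₁] [NeZero r₂] [Nonempty B] [Nonempty C]
    {Z : CodeMap A' B C r₁ r₂} (hZ : IsPPTNSCode Z) :
    ∃ ρ m, PrimalFeasible (codeOperator Z) ρ m := by
  obtain ⟨Φ, hΦ, h⟩ := hZ.forwardAssisted.causal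
  have hp := posSemidef_kronecker_add_transposeSnd_codeOperator hZ.pptPreserving.ppt_a h
    (s := 1) (by norm_num)
  have hm := posSemidef_kronecker_add_transposeSnd_codeOperator hZ.pptPreserving.ppt_a h
    (s := -1) (by norm_num)
  rw [Complex.ofReal_one, one_smul] at hp
  rw [Complex.ofReal_neg, Complex.ofReal_one, neg_one_smul, ← sub_eq_add_neg] at hm
  refine ⟨codeMarginal r₁ r₂ Φ, _, posSemidef_codeOperator hZ.forwardAssisted.channel, ?_,
    trace_codeMarginal hΦ, traceFst_codeOperator hZ.noSignalling.a_to_bc, ?_, hm⟩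
  -- ρ⊗1 is half the sum of the two bounds; its diagonal block at x is ρ.
  · obtain ⟨x⟩ := (inferInstance : Nonempty (B × C))
    convert ((hp.add hm).smul (show (0 : ℝ) ≤ 1 / 2 by norm_num)).submatrix
      (fun i : A' => (i, x)) using 1
    ext i j
    simp
    ring
  · rwa [sub_neg_eq_add, add_comm]


variable [DecidableEq A']

/-- Of the factor (r₁r₂)⁻² from the two normalized entangled states, one power is absorbed in the
code operator. -/
theorem channelFidelity_eq_trace_codeOperator (N : Op A' →ₗ[ℂ] Op (B × C))
    (Z : CodeMap A' B C r₁ r₂) :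
    channelFidelity N Z =
      ((r₁ * r₂ : ℕ) : ℝ)⁻¹ * (codeOperator Z * (choi N).transpose).trace.re := by
  rw [channelFidelity_eq, pow_two, mul_assoc, ← Complex.ofReal_natCast, ← Complex.ofReal_inv,
    Complex.re_ofReal_mul]
  congr 2
  rw [codeOperator, Matrix.smul_mul, Matrix.trace_smul, smul_eq_mul, Complex.ofReal_inv,
    Complex.ofReal_natCast]
  congr 1
  have h1 : ∀ a b, induced Z N (Matrix.single a b 1) a b = ∑ p : A' × B × C, ∑ q : A' × B × C,
      choi Z ((a, p.2), (p.1, a)) ((b, q.2), (q.1, b)) * choi N p q := by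
    intro a b
    simp only [induced, LinearMap.coe_mk, AddHom.coe_mk, Matrix.of_apply, code_single_kronecker,
      Matrix.sum_apply, Matrix.smul_apply, smul_eq_mul, choi_apply]
    rw [Fintype.sum_prod_type]
    refine Finset.sum_congr rfl fun i _ => ?_
    simp only [Fintype.sum_prod_type (f := fun q : A' × B × C => _)]
    rw [Finset.sum_comm]
    refine Finset.sum_congr rfl fun x _ => Finset.sum_congr rfl fun j _ => ?_
    exact Finset.sum_congr rfl fun y _ => mul_comm _ _
  simp only [h1, Matrix.trace, Matrix.diag_apply, Matrix.mul_apply, Matrix.transpose_apply,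
    Matrix.of_apply, Finset.sum_mul]
  calc ∑ a, ∑ b, ∑ p : A' × B × C, ∑ q : A' × B × C,
        choi Z ((a, p.2), (p.1, a)) ((b, q.2), (q.1, b)) * choi N p q
      = ∑ a, ∑ p : A' × B × C, ∑ q : A' × B × C, ∑ b,
        choi Z ((a, p.2), (p.1, a)) ((b, q.2), (q.1, b)) * choi N p q :=
        Finset.sum_congr rfl fun a _ => Finset.sum_comm.trans
          (Finset.sum_congr rfl fun p _ => Finset.sum_comm)
    _ = _ := Finset.sum_comm.trans (Finset.sum_congr rfl fun p _ => Finset.sum_comm)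

theorem IsPPTNSCode.mul_channelFidelity_le [NeZero r₁] [NeZero r₂] [Nonempty A'] [Nonempty B]
    [Nonempty C] {N : Op A' →ₗ[ℂ] Op (B × C)} (hN : IsChannel N)
    {Z : CodeMap A' B C r₁ r₂} (hZ : IsPPTNSCode Z) :
    channelFidelity N Z ≤ ((r₁ * r₂ : ℕ) : ℝ)⁻¹ * gammaValue N := by
  obtain ⟨ρ, m, h⟩ := hZ.exists_primalFeasible
  rw [channelFidelity_eq_trace_codeOperator]
  gcongr
  exact (isGreatest_gammaValue hN).2 ⟨_, _, _, h, rfl⟩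

end CodeBound

/-! ### The completely depolarizing code, which shows that codes of every size exist. -/

section Depolarizing

/-- The completely depolarizing channel. -/
noncomputable def depolarizing (ι o : Type*) [Fintype ι] [Fintype o] [DecidableEq o] :
    Op ι →ₗ[ℂ] Op o :=
  (Matrix.traceLinearMap ι ℂ ℂ).smulRight ((Fintype.card o : ℂ)⁻¹ • (1 : Op o))

variable {ι o : Type*} [Fintype ι] [Fintype o] [DecidableEq o]

theorem depolarizing_apply (X : Op ι) :
    depolarizing ι o X = X.trace • (Fintype.card o : ℂ)⁻¹ • (1 : Op o) := rfl

theorem isChannel_depolarizing [Nonempty o] : IsChannel (depolarizing ι o) where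
  completelyPositive k X hX := by
    have : idTensor (depolarizing ι o) X =
        traceSnd X ⊗ₖ ((Fintype.card o : ℂ)⁻¹ • (1 : Op o)) := rfl
    rw [this]
    exact (posSemidef_traceSnd hX).kronecker (Matrix.PosSemidef.one.smul (by positivity))
  tracePreserving X := by
    simp [depolarizing_apply]

theorem choi_depolarizing [DecidableEq ι] :
    choi (depolarizing ι o) = (Fintype.card o : ℂ)⁻¹ • 1 := by
  ext p q
  rw [choi_apply, depolarizing_apply]
  obtain ⟨a, b⟩ := p
  obtain ⟨c, d⟩ := q
  by_cases h : a = c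
  · subst h
    simp [Matrix.one_apply]
  · simp [Matrix.one_apply, h, Matrix.trace_single_eq_of_ne]

variable {A B C A' B' C' : Type*}

theorem transposeA_smul_one [DecidableEq A] [DecidableEq B] [DecidableEq C] [DecidableEq A']
    [DecidableEq B'] [DecidableEq C'] (c : ℂ) :
    transposeA (c • (1 : Op ((A × B × C) × (A' × B' × C')))) = c • 1 := by
  ext p q
  simp only [transposeA, Matrix.of_apply, Matrix.smul_apply, Matrix.one_apply, Prod.ext_iff]
  congr 2
  grind

theorem transposeB_smul_one [DecidableEq A] [DecidableEq B] [DecidableEq C] [DecidableEq A']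
    [DecidableEq B'] [DecidableEq C'] (c : ℂ) :
    transposeB (c • (1 : Op ((A × B × C) × (A' × B' × C')))) = c • 1 := by
  ext p q
  simp only [transposeB, Matrix.of_apply, Matrix.smul_apply, Matrix.one_apply, Prod.ext_iff]
  congr 2
  grind

theorem transposeC_smul_one [DecidableEq A] [DecidableEq B] [DecidableEq C] [DecidableEq A']
    [DecidableEq B'] [DecidableEq C'] (c : ℂ) :
    transposeC (c • (1 : Op ((A × B × C) × (A' × B' × C')))) = c • 1 := by
  ext p q
  simp only [transposeC, Matrix.of_apply, Matrix.smul_apply, Matrix.one_apply, Prod.ext_iff]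
  congr 2
  grind

variable [Fintype A] [Fintype B] [Fintype C] [Fintype A'] [Fintype B'] [Fintype C']
  [DecidableEq A'] [DecidableEq B'] [DecidableEq C'] [Nonempty A'] [Nonempty B'] [Nonempty C']

theorem noSignalAtoBC_depolarizing :
    NoSignalAtoBC (depolarizing (A × B × C) (A' × B' × C')) := by
  refine ⟨depolarizing _ _, isChannel_depolarizing, fun X => ?_⟩
  rw [depolarizing_apply, depolarizing_apply, traceFst_smul, trace_traceFst, traceFst_smul,
    ← Matrix.one_kronecker_one, traceFst_one_kronecker, smul_smul _ _ (1 : Op (B' × C'))]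
  congr 2
  simp

theorem noSignalBCtoA_depolarizing :
    NoSignalBCtoA (depolarizing (A × B × C) (A' × B' × C')) := by
  refine ⟨depolarizing _ _, isChannel_depolarizing, fun X => ?_⟩
  rw [depolarizing_apply, depolarizing_apply, trace_traceSnd]
  ext i j
  by_cases h : i = j
  · subst h
    simp [traceSnd]
    field_simp
  · simp [traceSnd, Matrix.one_apply, h]

theorem noSignalBtoAC_depolarizing :
    NoSignalBtoAC (depolarizing (A × B × C) (A' × B' × C')) := by
  refine ⟨depolarizing _ _, isChannel_depolarizing, fun X => ?_⟩
  have h : (traceMid X).trace = X.trace := by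
    simp only [traceMid, Matrix.trace, Matrix.diag_apply, Matrix.of_apply, Fintype.sum_prod_type]
    exact Finset.sum_congr rfl fun _ _ => Finset.sum_comm
  rw [depolarizing_apply, depolarizing_apply, h]
  ext ⟨i, j⟩ ⟨k, l⟩
  by_cases h : i = k ∧ j = l
  · obtain ⟨rfl, rfl⟩ := h
    simp [traceMid]
    field_simp
  · simp [traceMid, Matrix.one_apply, h]

theorem noSignalCtoAB_depolarizing :
    NoSignalCtoAB (depolarizing (A × B × C) (A' × B' × C')) := by
  refine ⟨depolarizing _ _, isChannel_depolarizing, fun X => ?_⟩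
  have h : (traceLast X).trace = X.trace := by
    simp only [traceLast, Matrix.trace, Matrix.diag_apply, Matrix.of_apply, Fintype.sum_prod_type]
  rw [depolarizing_apply, depolarizing_apply, h]
  ext ⟨i, j⟩ ⟨k, l⟩
  by_cases h : i = k ∧ j = l
  · obtain ⟨rfl, rfl⟩ := h
    simp [traceLast]
    field_simp
  · simp [traceLast, Matrix.one_apply, h]

theorem isPPTPreserving_depolarizing [DecidableEq A] [DecidableEq B] [DecidableEq C] :
    IsPPTPreserving (depolarizing (A × B × C) (A' × B' × C')) where
  ppt_a := by
    rw [choi_depolarizing, transposeA_smul_one]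
    exact Matrix.PosSemidef.one.smul (by positivity)
  ppt_b := by
    rw [choi_depolarizing, transposeB_smul_one]
    exact Matrix.PosSemidef.one.smul (by positivity)
  ppt_c := by
    rw [choi_depolarizing, transposeC_smul_one]
    exact Matrix.PosSemidef.one.smul (by positivity)

theorem isPPTNSCode_depolarizing [DecidableEq B] [DecidableEq C] (r₁ r₂ : ℕ) [NeZero r₁]
    [NeZero r₂] :
    IsPPTNSCode (depolarizing ((Fin r₁ × Fin r₂) × B × C) (A' × Fin r₁ × Fin r₂) :
      CodeMap A' B C r₁ r₂) where
  forwardAssisted := ⟨isChannel_depolarizing, noSignalBCtoA_depolarizing⟩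
  noSignalling := ⟨noSignalAtoBC_depolarizing, noSignalBtoAC_depolarizing,
    noSignalCtoAB_depolarizing⟩
  pptPreserving := isPPTPreserving_depolarizing

theorem channelFidelity_depolarizing [DecidableEq B] [DecidableEq C]
    {N : Op A' →ₗ[ℂ] Op (B × C)} (hN : IsChannel N) :
    channelFidelity N (depolarizing ((Fin 1 × Fin 1) × B × C) (A' × Fin 1 × Fin 1) :
      CodeMap A' B C 1 1) = 1 := by
  have h : ∀ a b : Fin 1 × Fin 1, ∀ i j : A',
      depolarizing ((Fin 1 × Fin 1) × B × C) (A' × Fin 1 × Fin 1)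
        (Matrix.single a b 1 ⊗ₖ N (Matrix.single i j 1)) (i, a) (j, b) =
      if i = j then (Fintype.card A' : ℂ)⁻¹ else 0 := by
    intro a b i j
    obtain rfl := Subsingleton.elim a b
    rw [depolarizing_apply, Matrix.trace_kronecker, hN.tracePreserving, Matrix.trace_single_eq_same]
    by_cases hij : i = j
    · subst hij
      simp
    · simp [Matrix.trace_single_eq_of_ne _ _ _ hij, hij]
  rw [channelFidelity_eq]
  simp [induced, h]

end Depolarizing

/-! ### The capacity bound. -/

section Capacity

variable {A' B C : Type*} [Fintype A'] [Fintype B] [Fintype C]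
  [DecidableEq A'] [DecidableEq B] [DecidableEq C] [Nonempty A'] [Nonempty B] [Nonempty C]
  {N : Op A' →ₗ[ℂ] Op (B × C)}

theorem maxFidelity_le (hN : IsChannel N) {r₁ r₂ : ℕ} (h₁ : 1 ≤ r₁) (h₂ : 1 ≤ r₂) :
    maxFidelity N r₁ r₂ ≤ ((r₁ * r₂ : ℕ) : ℝ)⁻¹ * gammaValue N := by
  have : NeZero r₁ := ⟨by omega⟩
  have : NeZero r₂ := ⟨by omega⟩
  -- The depolarizing code makes the set of fidelities nonempty.
  refine csSup_le ⟨_, _, isPPTNSCode_depolarizing r₁ r₂, rfl⟩ ?_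
  rintro f ⟨Z, hZ, rfl⟩
  exact hZ.mul_channelFidelity_le hN

theorem one_le_maxFidelity_one_one (hN : IsChannel N) : 1 ≤ maxFidelity N 1 1 := by
  refine le_csSup ⟨((1 * 1 : ℕ) : ℝ)⁻¹ * gammaValue N, ?_⟩
    ⟨_, isPPTNSCode_depolarizing 1 1, channelFidelity_depolarizing hN⟩
  rintro f ⟨Z, hZ, rfl⟩
  exact hZ.mul_channelFidelity_le hN

theorem mul_le_of_le_maxFidelity (hN : IsChannel N) {ε : ℝ} {r₁ r₂ : ℕ}
    (h₁ : 1 ≤ r₁) (h₂ : 1 ≤ r₂) (h : 1 - ε ≤ maxFidelity N r₁ r₂) :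
    ((r₁ * r₂ : ℕ) : ℝ) * (1 - ε) ≤ gammaValue N := by
  have hpos : (0 : ℝ) < (r₁ * r₂ : ℕ) := by exact_mod_cast Nat.mul_pos h₁ h₂
  rw [← le_inv_mul_iff₀ hpos]
  exact h.trans (maxFidelity_le hN h₁ h₂)

/-- Both sizes are at least 1, so each is bounded by the product r₁r₂ ≤ Γ/(1-ε). -/
theorem finite_achievableSumRates (hN : IsChannel N) {ε : ℝ} (hε : ε < 1) :
    (achievableSumRates N ε).Finite := by
  have hε' : 0 < 1 - ε := by linarith
  obtain ⟨n, hn⟩ := exists_nat_ge (gammaValue N / (1 - ε))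
  refine (((Set.finite_Iic n).prod (Set.finite_Iic n)).image fun r : ℕ × ℕ =>
    Real.logb 2 r.1 + Real.logb 2 r.2).subset ?_
  rintro R ⟨r₁, r₂, h₁, h₂, h, rfl⟩
  have hle : r₁ * r₂ ≤ n := by
    exact_mod_cast ((le_div_iff₀ hε').mpr (mul_le_of_le_maxFidelity hN h₁ h₂ h)).trans hn
  exact ⟨(r₁, r₂), ⟨(Nat.le_mul_of_pos_right r₁ h₂).trans hle,
    (Nat.le_mul_of_pos_left r₂ h₁).trans hle⟩, rfl⟩

theorem isGreatest_oneShotSumCapacity (hN : IsChannel N) {ε : ℝ} (h0 : 0 ≤ ε) (hε : ε < 1) :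
    IsGreatest (achievableSumRates N ε) (oneShotSumCapacity N ε) := by
  have hne : (achievableSumRates N ε).Nonempty :=
    ⟨_, 1, 1, le_rfl, le_rfl, by linarith [one_le_maxFidelity_one_one hN], rfl⟩
  have hf := finite_achievableSumRates hN hε
  exact ⟨hne.csSup_mem hf, fun R hR => le_csSup hf.bddAbove hR⟩

theorem oneShotSumCapacity_le (hN : IsChannel N) {ε : ℝ} (h0 : 0 ≤ ε) (hε : ε < 1) :
    oneShotSumCapacity N ε ≤ Real.logb 2 (gammaValue N) - Real.logb 2 (1 - ε) := by
  obtain ⟨r₁, r₂, h₁, h₂, h, heq⟩ := (isGreatest_oneShotSumCapacity hN h0 hε).1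
  have hε' : 0 < 1 - ε := by linarith
  have hr₁ : (0 : ℝ) < r₁ := by exact_mod_cast h₁
  have hr₂ : (0 : ℝ) < r₂ := by exact_mod_cast h₂
  have hle := mul_le_of_le_maxFidelity hN h₁ h₂ h
  push_cast at hle
  rw [heq, le_sub_iff_add_le, ← Real.logb_mul hr₁.ne' hr₂.ne', ← Real.logb_mul (by positivity)
    hε'.ne']
  exact Real.logb_le_logb_of_le one_lt_two (by positivity) hle

end Capacity

end BroadcastCode

theorem mainTheorem5 {A' B C : Type*} [Fintype A'] [Fintype B] [Fintype C]
    [DecidableEq A'] [DecidableEq B] [DecidableEq C] [Nonempty A'] [Nonempty B] [Nonempty C]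
    (N : BroadcastCode.Op A' →ₗ[ℂ] BroadcastCode.Op (B × C)) (hN : BroadcastCode.IsChannel N) :
    (∀ ε : ℝ, 0 ≤ ε → ε < 1 →
      IsGreatest (BroadcastCode.achievableSumRates N ε) (BroadcastCode.oneShotSumCapacity N ε) ∧
      BroadcastCode.oneShotSumCapacity N ε ≤
        Real.logb 2 (BroadcastCode.gammaValue N) - Real.logb 2 (1 - ε)) ∧
    0 < BroadcastCode.gammaValue N ∧
    IsGreatest (BroadcastCode.primalValues N) (BroadcastCode.gammaValue N) ∧
    IsLeast (BroadcastCode.dualValues N) (BroadcastCode.gammaValue N) :=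
  ⟨fun _ h0 hε => ⟨BroadcastCode.isGreatest_oneShotSumCapacity hN h0 hε,
    BroadcastCode.oneShotSumCapacity_le hN h0 hε⟩, BroadcastCode.gammaValue_pos hN,
    BroadcastCode.isGreatest_gammaValue hN, BroadcastCode.isLeast_dualValues hN⟩
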